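/- **Setting.** Let $T$ be the set of $(m+1)$-coloured rooted trees (colours $0,\dots,m$; the order of branches is irrelevant), including the empty tree $\emptyset$; $[\tau_1,\dots,\tau_\kappa]_l$ is the tree with root of colour $l$ and nonempty branches $\tau_1,\dots,\tau_\kappa$, and $\bullet_l$ is the single vertex. Let $2\rho(\tau)$ be the number of vertices, those of colour $0$ counted twice. Let $g_0,\dots,g_m:\mathbb R^d\to\mathbb R^d$ be $C^\infty$, and put $F(\emptyset)(x)=x$, $F([\tau_1,\dots,\tau_\kappa]_l)(x)=g_l^{(\kappa)}(x)(F(\tau_1)(x),\dots,F(\tau_\kappa)(x))$, $\alpha(\emptyset)=1$, $\alpha([\tau_1,\dots,\tau_\kappa]_l)=\frac1{r_1!\cdots r_q!}\prod_j\alpha(\tau_j)$, where $r_1,\dots,r_q$ are the multiplicities of the distinct trees among $\tau_1,\dots,\tau_\kappa$. Let $\Omega$ be a nonempty measurable space and $\Xi$ the algebra of families $(\varphi(h))_{h\ge0}$ of measurable functions $\Omega\to\mathbb R$. For a weight function $\phi:T\to\Xi$, the B-series $$B(\phi,x_0;h)=\sum_{\tau\in T}\alpha(\tau)\,\phi(\tau)(h)\,F(\tau)(x_0)$$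 is a formal series, graded by the order: the term of $\tau$ is the coefficient of $t^{2\rho(\tau)}$ of a formal variable $t$. $B(\phi,Y;h)$ and $\partial_2B(\phi,Y;h)V$ for formal series $Y,V$ with coefficients in $\mathbb R^d$ are obtained by Taylor expansion of $F(\tau)(Y)$ and $F(\tau)'(Y)V$. Equalities of formal series hold coefficientwise, for every $h\ge0$ and every $\omega\in\Omega$. For $\tau\in T$ let $ST(\tau)$ be the set of pairs $(\vartheta,\omega)$ of a subtree $\vartheta$ sharing the root with $\tau$ (or $\vartheta=\emptyset$, $\omega=\{\tau\}$ for $\tau\ne\emptyset$; $ST(\emptyset)=\{(\emptyset,\emptyset)\}$) and the multiset $\omega$ of trees left over when $\vartheta$ is removed from $\tau$; $\gamma(\tau,\vartheta,\omega)$ is the number of ways in which $(\vartheta,\omega)$ arises when the branches of $\tau$ are ordered; $SP(\tau)\subset ST(\tau)$ consists of the pairs in which $\omega$ has exactly one element. Put $e(\emptyset)=1$, $e(\tau)=0$ otherwise, and $$(\phi_x\circ\phi_y)(\tau)=\sum_{(\vartheta,\omega)\in ST(\tau)}\gamma(\tau,\vartheta,\omega)\,\phi_y(\vartheta)\prod_{\delta\in\omega}\phi_x(\delta);$$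 $\phi^{-1}$ is determined recursively by $\phi\circ\phi^{-1}=e$. If $\phi_x(\emptyset)=0$, put $(\phi_x*\phi_y)(\emptyset)=0$ and $(\phi_x*\phi_y)(\tau)=\sum_{(\vartheta,\{\delta\})\in SP(\tau)}\gamma(\tau,\vartheta,\{\delta\})\phi_y(\vartheta)\phi_x(\delta)$ for $\tau\neq\emptyset$; in general $\phi_x*\phi_y=(\phi_x-\phi_x(\emptyset)e)*\phi_y+\phi_x(\emptyset)\phi_y$. **Statement.** Let $\Phi_{ex},\Phi_{im},\Phi_0:T\to\Xi$ with $\Phi_{ex}(\emptyset)\equiv1$, $\Phi_{im}(\emptyset)\equiv0$, $\Phi_0(\emptyset)\equiv1$. 1. There are a unique $\Phi:T\to\Xi$ (the weight function of the exact numerical solution) with $\Phi(\emptyset)\equiv1$, $\Phi(\tau)=\Phi_{ex}(\tau)+(\Phi\circ\Phi_{im})(\tau)$ for all $\tau$, and a unique sequence $\Phi_1,\Phi_2,\dots:T\to\Xi$ with, for all $k\ge0$ and all $\tau\in T$, $$\Phi_{k+1}(\emptyset)\equiv1,\qquad \Phi_{k+1}(\tau)=\Phi_{ex}(\tau)+\bigl(\Phi_k\circ((\Phi_k^{-1}\circ\Phi_{k+1})*\Phi_{im})\bigr)(\tau).$$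 2. For every $x_0\in\mathbb R^d$, a sequence of formal series $Y_{1,0},Y_{1,1},\dots$ is the sequence of full Newton iterates with predictor $Y_{1,0}=B(\Phi_0,x_0;h)$, i.e. satisfies this and $$Y_{1,k+1}=B(\Phi_{ex},x_0;h)+B(\Phi_{im},Y_{1,k};h)+\partial_2B(\Phi_{im},Y_{1,k};h)\,(Y_{1,k+1}-Y_{1,k})\qquad(k\ge0),$$ if and only if $Y_{1,k}=B(\Phi_k,x_0;h)$ for all $k\ge0$. 3. Define the doubling index by $\mathfrak d(\emptyset)=0$, $\mathfrak d(\bullet_l)=1$, and for $\kappa\ge1$ let $\mathfrak d([\tau_1,\dots,\tau_\kappa]_l)$ be $\max_j\mathfrak d(\tau_j)$ if exactly one $\tau_i$ attains this maximum, and $\max_j\mathfrak d(\tau_j)+1$ if at least two do. Then $\mathfrak d$ is a growth function: for every $k\ge0$, if $\Phi_k(\tau)=\Phi(\tau)$ for all $\tau$ with $\mathfrak d(\tau)\le k$, then $\Phi_{k+1}(\tau)=\Phi(\tau)$ for all $\tau$ with $\mathfrak d(\tau)\le k+1$. Consequently $\Phi_k(\tau)=\Phi(\tau)$ whenever $\mathfrak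 d(\tau)\le k$. 4. This is sharp in general: $\Phi_{ex},\Phi_{im},\Phi_0$ as above can be chosen such that $\Phi_k(\tau)\ne\Phi(\tau)$ whenever $k<\mathfrak d(\tau)$. -/

import Mathlib

open scoped NNReal ContDiff

namespace BSeries

/-! ### Coloured rooted trees -/

/-- Ordered (plane) rooted trees whose vertices carry one of the colours `0, …, m`. -/
inductive OTree (m : ℕ) : Type
  | node (l : Fin (m + 1)) (c : List (OTree m)) : OTree m

/-- Two ordered trees are related if one arises from the other by permuting the branches at one
vertex. -/
inductive OTree.Step {m : ℕ} : OTree m → OTree m → Prop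
  | perm (l : Fin (m + 1)) {c c' : List (OTree m)} (h : c.Perm c') :
      OTree.Step (OTree.node l c) (OTree.node l c')
  | child (l : Fin (m + 1)) (c₁ c₂ : List (OTree m)) {a b : OTree m} (h : OTree.Step a b) :
      OTree.Step (OTree.node l (c₁ ++ a :: c₂)) (OTree.node l (c₁ ++ b :: c₂))

/-- The number of vertices of an ordered tree. -/
def OTree.size {m : ℕ} : OTree m → ℕ
  | OTree.node _ c => 1 + (c.map fun t => OTree.size t).sum

/-- Nonempty `(m+1)`-coloured rooted trees (the order of the branches is irrelevant). -/
def Tree (m : ℕ) : Type := Quot (@OTree.Step m)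

/-- The set `T` of all `(m+1)`-coloured rooted trees; `none` is the empty tree `∅`. -/
abbrev T (m : ℕ) : Type := Option (Tree m)

namespace Tree

variable {m : ℕ}

theorem size_step {a b : OTree m} (h : OTree.Step a b) : a.size = b.size := by
  induction h with
  | perm l h => simp only [OTree.size]; rw [(h.map _).sum_eq]
  | child l c₁ c₂ _ ih => simp [OTree.size, ih]

/-- The number of vertices. -/
def size (τ : Tree m) : ℕ := Quot.lift OTree.size (fun _ _ h => size_step h) τ

/-- The colour of the root. -/
def root (τ : Tree m) : Fin (m + 1) :=
  Quot.lift (fun t : OTree m => match t with | OTree.node l _ => l)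
    (fun _ _ h => by cases h <;> rfl) τ

/-- The tree underlying an ordered tree. -/
def mk (t : OTree m) : Tree m := Quot.mk OTree.Step t

/-- An ordered tree representing a given tree. -/
noncomputable def out (τ : Tree m) : OTree m := Quot.out τ

theorem mk_out (τ : Tree m) : mk τ.out = τ := Quot.out_eq τ

theorem mk_step {a b : OTree m} (h : OTree.Step a b) : mk a = mk b := Quot.sound h

/-- The multiset `τ₁, …, τ_κ` of branches of `τ = [τ₁, …, τ_κ]_l`. -/
def children (τ : Tree m) : Multiset (Tree m) :=
  Quot.lift
    (fun t : OTree m => match t with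
      | OTree.node _ c => ((c.map mk : List (Tree m)) : Multiset (Tree m)))
    (fun _ _ h => by
      cases h with
      | perm l h => exact Multiset.coe_eq_coe.2 (h.map _)
      | child l c₁ c₂ h => simp [mk_step h]) τ

/-- `node l {τ₁, …, τ_κ}` is the tree `[τ₁, …, τ_κ]_l`; `node l 0` is the single vertex `•_l`. -/
noncomputable def node (l : Fin (m + 1)) (s : Multiset (Tree m)) : Tree m :=
  Quotient.lift (fun c : List (Tree m) => mk (OTree.node l (c.map out)))
    (fun _ _ h => mk_step (OTree.Step.perm l (List.Perm.map out h))) s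

@[simp] theorem root_node (l : Fin (m + 1)) (s : Multiset (Tree m)) : (node l s).root = l := by
  induction s using Quotient.inductionOn; rfl

@[simp] theorem children_node (l : Fin (m + 1)) (s : Multiset (Tree m)) :
    (node l s).children = s := by
  induction s using Quotient.inductionOn with
  | h c =>
    change (((c.map out).map mk : List (Tree m)) : Multiset (Tree m)) = (c : Multiset (Tree m))
    have : (mk ∘ out : Tree m → Tree m) = id := by
      funext t; exact mk_out t
    rw [List.map_map, this, List.map_id]

theorem mk_child (l : Fin (m + 1)) (c₁ c₂ : List (OTree m)) {a b : OTree m} (h : mk a = mk b) :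
    mk (OTree.node l (c₁ ++ a :: c₂)) = mk (OTree.node l (c₁ ++ b :: c₂)) := by
  have h' := Quot.eqvGen_exact h
  clear h
  induction h' with
  | rel a b h => exact mk_step (OTree.Step.child l c₁ c₂ h)
  | refl a => rfl
  | symm a b _ ih => exact ih.symm
  | trans a b c _ _ ih₁ ih₂ => exact ih₁.trans ih₂

theorem mk_map_out (l : Fin (m + 1)) (c₂ c₁ : List (OTree m)) :
    mk (OTree.node l (c₁ ++ (c₂.map mk).map out)) = mk (OTree.node l (c₁ ++ c₂)) := by
  induction c₂ generalizing c₁ with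
  | nil => rfl
  | cons a c₂ ih =>
    rw [List.map_cons, List.map_cons, mk_child l c₁ _ (b := a) (mk_out _)]
    simpa using ih (c₁ ++ [a])

@[simp] theorem node_root_children (τ : Tree m) : node τ.root τ.children = τ := by
  induction τ using Quot.inductionOn with
  | h t =>
    cases t with
    | node l c => exact mk_map_out l c []

theorem size_eq (τ : Tree m) : τ.size = 1 + (τ.children.map size).sum := by
  induction τ using Quot.inductionOn with
  | h t =>
    cases t with
    | node l c =>
      change OTree.size (OTree.node l c) =
        1 + ((((c.map mk : List (Tree m)) : Multiset (Tree m))).map size).sum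
      rw [OTree.size, Multiset.map_coe, Multiset.sum_coe, List.map_map]; rfl

theorem size_lt {τ c : Tree m} (h : c ∈ τ.children) : c.size < τ.size := by
  have h1 := Multiset.single_le_sum (s := τ.children.map size) (fun _ _ => Nat.zero_le _) _
    (Multiset.mem_map_of_mem size h)
  rw [size_eq τ]; omega

open Classical in
/-- The symmetry coefficient `α([τ₁, …, τ_κ]_l) = (r₁! ⋯ r_q!)⁻¹ ∏ α(τ_j)`, where the `r_i` are the
multiplicities of the distinct trees among `τ₁, …, τ_κ`. -/
noncomputable def alpha (τ : Tree m) : ℚ :=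
  (∏ c ∈ τ.children.toFinset, ((τ.children.count c).factorial : ℚ))⁻¹ *
    (τ.children.attach.map fun c => alpha c.1).prod
termination_by τ.size
decreasing_by exact size_lt c.2

/-- Twice the order `ρ`: vertices of colour `0` count `2`, all others count `1`. -/
noncomputable def order2 (τ : Tree m) : ℕ :=
  (if τ.root = 0 then 2 else 1) + (τ.children.attach.map fun c => order2 c.1).sum
termination_by τ.size
decreasing_by exact size_lt c.2

theorem order2_eq (τ : Tree m) :
    τ.order2 = (if τ.root = 0 then 2 else 1) + (τ.children.map order2).sum := by
  rw [order2, Multiset.attach_map_val' τ.children order2]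

/-- The doubling index: `1` on single vertices, otherwise the maximum over the branches, plus one if
this maximum is attained by at least two branches. -/
noncomputable def doubling (τ : Tree m) : ℕ :=
  let ds : Multiset ℕ := τ.children.attach.map fun c => doubling c.1
  if ds = 0 then 1 else if 2 ≤ ds.count ds.sup then ds.sup + 1 else ds.sup
termination_by τ.size
decreasing_by exact size_lt c.2

/-- The elementary differential
`F([τ₁, …, τ_κ]_l)(x) = g_l^{(κ)}(x) (F(τ₁)(x), …, F(τ_κ)(x))`. The branches are listed in an
arbitrary order, which is immaterial for smooth `g_l`, whose derivatives are symmetric. -/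
noncomputable def elemDiff {E : Type*} [NormedAddCommGroup E] [NormedSpace ℝ E]
    (g : Fin (m + 1) → E → E) (τ : Tree m) (x : E) : E :=
  iteratedFDeriv ℝ τ.children.toList.length (g τ.root) x
    (fun i => elemDiff g (τ.children.toList.get i) x)
termination_by τ.size
decreasing_by exact size_lt (Multiset.mem_toList.1 (List.get_mem _ _))

/-- All pairs `(ϑ, ω)` of a subtree `ϑ` of `τ` sharing the root with `τ` (or `ϑ = ∅`) and the
multiset `ω` of trees left over when `ϑ` is removed, each pair listed as often as it arises when the
branches are regarded as distinguishable: either `(∅, {τ})`, or `ϑ = [ϑ₁, …, ϑ_κ]_l` and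
`ω = ω₁ ∪ … ∪ ω_κ` with `(ϑ_i, ω_i)` such a pair for `τ_i`, empty `ϑ_i` being dropped. -/
noncomputable def cuts (τ : Tree m) : Multiset (T m × Multiset (Tree m)) :=
  (none, {τ}) ::ₘ
    (Multiset.Sections (τ.children.attach.map fun c => cuts c.1)).map fun c =>
      (some (node τ.root (c.filterMap Prod.fst)), (c.map Prod.snd).sum)
termination_by τ.size
decreasing_by exact size_lt c.2

theorem size_pos (τ : Tree m) : 0 < τ.size := by rw [size_eq]; omega

theorem induction_children {p : Tree m → Prop}
    (h : ∀ τ : Tree m, (∀ c ∈ τ.children, p c) → p τ) (τ : Tree m) : p τ := by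
  induction hn : τ.size using Nat.strong_induction_on generalizing τ with
  | _ n ih => exact h τ fun c hc => ih c.size (hn ▸ size_lt hc) c rfl

theorem size_le_order2 (τ : Tree m) : τ.size ≤ τ.order2 := by
  induction τ using induction_children with
  | h τ ih =>
    rw [size_eq, order2_eq]
    refine Nat.add_le_add (by split_ifs <;> omega) ?_
    exact Multiset.sum_map_le_sum_map _ _ ih

theorem finite_multiset_card_le {β : Type*} {s : Set β} (hs : s.Finite) (n : ℕ) :
    {t : Multiset β | t.card ≤ n ∧ ∀ x ∈ t, x ∈ s}.Finite := by
  induction n with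
  | zero =>
    refine (Set.finite_singleton (0 : Multiset β)).subset ?_
    rintro t ⟨h, -⟩
    simpa using h
  | succ n ih =>
    refine ((Set.finite_singleton (0 : Multiset β)).union
      (Set.Finite.image2 (fun a t => a ::ₘ t) hs ih)).subset ?_
    rintro t ⟨h1, h2⟩
    induction t using Multiset.induction_on with
    | empty => exact Or.inl rfl
    | cons a t _ =>
      refine Or.inr ⟨a, h2 a (Multiset.mem_cons_self a t), t, ⟨?_, fun x hx =>
        h2 x (Multiset.mem_cons_of_mem hx)⟩, rfl⟩
      rw [Multiset.card_cons] at h1; omega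

theorem finite_size_le (n : ℕ) : {τ : Tree m | τ.size ≤ n}.Finite := by
  induction n with
  | zero =>
    refine Set.finite_empty.subset fun τ h => ?_
    have := size_pos τ
    simp only [Set.mem_ofPred_eq] at h
    omega
  | succ n ih =>
    refine (Set.Finite.image2 node (Set.finite_univ (α := Fin (m + 1)))
      (finite_multiset_card_le ih n)).subset fun τ h => ?_
    simp only [Set.mem_ofPred_eq] at h
    rw [size_eq] at h
    refine ⟨τ.root, Set.mem_univ _, τ.children, ⟨?_, fun c hc => ?_⟩, node_root_children τ⟩
    · have h1 : (τ.children.map fun _ => 1).sum ≤ (τ.children.map size).sum :=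
        Multiset.sum_map_le_sum_map _ _ fun c _ => size_pos c
      simp only [Multiset.map_const', Multiset.sum_replicate, smul_eq_mul, mul_one] at h1
      omega
    · have h1 := Multiset.single_le_sum (s := τ.children.map size) (fun _ _ => Nat.zero_le _) _
        (Multiset.mem_map_of_mem size hc)
      simp only [Set.mem_ofPred_eq]
      omega

end Tree

namespace T

variable {m : ℕ}

/-- The number of vertices. -/
def size : T m → ℕ
  | none => 0
  | some τ => τ.size

/-- The symmetry coefficient `α`. -/
noncomputable def alpha : T m → ℚ
  | none => 1
  | some τ => τ.alpha

/-- Twice the order `ρ` of a tree. -/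
noncomputable def order2 : T m → ℕ
  | none => 0
  | some τ => τ.order2

/-- The doubling index. -/
noncomputable def doubling : T m → ℕ
  | none => 0
  | some τ => τ.doubling

/-- The elementary differential `F(τ)`, with `F(∅)(x) = x`. -/
noncomputable def elemDiff {E : Type*} [NormedAddCommGroup E] [NormedSpace ℝ E]
    (g : Fin (m + 1) → E → E) : T m → E → E
  | none => fun x => x
  | some τ => Tree.elemDiff g τ

/-- All pairs `(ϑ, ω)` for `τ`, with multiplicity; the empty tree has only the pair `(∅, ∅)`. -/
noncomputable def cuts : T m → Multiset (T m × Multiset (Tree m))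
  | none => {(none, 0)}
  | some τ => τ.cuts

open Classical in
/-- The set `ST(τ)` of pairs `(ϑ, ω)` of a subtree and its remainder multiset. -/
noncomputable def ST (τ : T m) : Finset (T m × Multiset (Tree m)) := τ.cuts.toFinset

open Classical in
/-- The combinatorial coefficient `γ(τ, ϑ, ω)`: the number of equal terms `(ϑ, ω)` that arise when
the branches of `τ` are ordered. -/
noncomputable def gamma (τ : T m) (p : T m × Multiset (Tree m)) : ℕ := τ.cuts.count p

/-- The set `SP(τ)` of those pairs in `ST(τ)` whose remainder multiset has exactly one element. -/
noncomputable def SP (τ : T m) : Finset (T m × Multiset (Tree m)) :=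
  τ.ST.filter fun p => p.2.card = 1

theorem finite_order2 (N : ℕ) : {τ : T m | τ.order2 = N}.Finite := by
  refine ((Set.finite_singleton (none : T m)).union
    ((Tree.finite_size_le (m := m) N).image some)).subset ?_
  rintro (_ | τ) h
  · exact Or.inl rfl
  · exact Or.inr ⟨τ, (Tree.size_le_order2 τ).trans (le_of_eq h), rfl⟩

/-- The finitely many trees of order `N / 2`. -/
noncomputable def ofOrder2 (m N : ℕ) : Finset (T m) := (finite_order2 (m := m) N).toFinset

end T

/-! ### Operations on weight functions `φ : T → R` -/

section Weights

variable {m : ℕ} {R : Type*} [CommRing R]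

/-- The unit `e`. -/
def unitWeight : T m → R
  | none => 1
  | some _ => 0

/-- The composition
`(φx ∘ φy)(τ) = ∑_{(ϑ, ω) ∈ ST(τ)} γ(τ, ϑ, ω) φy(ϑ) ∏_{δ ∈ ω} φx(δ)`. -/
noncomputable def comp (φx φy : T m → R) (τ : T m) : R :=
  ∑ p ∈ τ.ST, (τ.gamma p : R) * (φy p.1 * (p.2.map fun δ => φx (some δ)).prod)

/-- The inverse `φ⁻¹`, computed recursively from `φ ∘ φ⁻¹ = e`: the term `φ⁻¹(τ)` of the composition
is isolated, the remaining ones have `ϑ` smaller than `τ`. -/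
noncomputable def inv (φ : T m → R) (τ : T m) : R :=
  unitWeight τ - ∑ p ∈ (τ.ST.filter fun p => p.1.size < τ.size).attach,
    (τ.gamma p.1 : R) * (inv φ p.1.1 * (p.1.2.map fun δ => φ (some δ)).prod)
termination_by τ.size
decreasing_by exact (Finset.mem_filter.1 p.2).2

/-- The operation `φx ∗ φy` when `φx(∅) = 0`:
`∑_{(ϑ, {δ}) ∈ SP(τ)} γ(τ, ϑ, {δ}) φy(ϑ) φx(δ)` for `τ ≠ ∅`, and `0` for `τ = ∅`. -/
noncomputable def starAux (φx φy : T m → R) : T m → R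
  | none => 0
  | some τ => ∑ p ∈ T.SP (some τ),
      (T.gamma (some τ) p : R) * (φy p.1 * (p.2.map fun δ => φx (some δ)).prod)

/-- The operation `∗` in general:
`φx ∗ φy = (φx - φx(∅) e) ∗ φy + φx(∅) φy`. -/
noncomputable def star (φx φy : T m → R) (τ : T m) : R :=
  starAux (fun σ => φx σ - φx none * unitWeight σ) φy τ + φx none * φy τ

/-- `Φ` is the weight function of the exact numerical solution:
`Φ(∅) = 1` and `Φ(τ) = Φ_ex(τ) + (Φ ∘ Φ_im)(τ)`. -/
def IsMethodWeight (Φex Φim Φ : T m → R) : Prop :=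
  Φ none = 1 ∧ ∀ τ, Φ τ = Φex τ + comp Φ Φim τ

/-- `Φ_0, Φ_1, …` satisfy the recursion of the full Newton iteration with predictor `Φ0`:
`Φ_{k+1}(∅) = 1` and `Φ_{k+1}(τ) = Φ_ex(τ) + (Φ_k ∘ ((Φ_k⁻¹ ∘ Φ_{k+1}) ∗ Φ_im))(τ)`. -/
def IsNewtonWeight (Φex Φim Φ0 : T m → R) (Φs : ℕ → T m → R) : Prop :=
  Φs 0 = Φ0 ∧ ∀ k, Φs (k + 1) none = 1 ∧
    ∀ τ, Φs (k + 1) τ =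
      Φex τ + comp (Φs k) (star (comp (inv (Φs k)) (Φs (k + 1))) Φim) τ

/-- `𝔤` is a growth function for the iterated weights `Φ_0, Φ_1, …` and the weights `Φ` of the exact
numerical solution. -/
def IsGrowthFunction (𝔤 : T m → ℕ) (Φ : T m → R) (Φs : ℕ → T m → R) : Prop :=
  ∀ k, (∀ τ, 𝔤 τ ≤ k → Φs k τ = Φ τ) → ∀ τ, 𝔤 τ ≤ k + 1 → Φs (k + 1) τ = Φ τ

end Weights

/-- The algebra `Ξ` of all families `(φ(h))_{h ≥ 0}` of random variables on `Ω`. -/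
def Xi (Ω : Type*) [MeasurableSpace Ω] : Subalgebra ℝ (ℝ≥0 → Ω → ℝ) where
  carrier := {φ | ∀ h, Measurable (φ h)}
  mul_mem' ha hb h := (ha h).mul (hb h)
  add_mem' ha hb h := (ha h).add (hb h)
  algebraMap_mem' _ _ := measurable_const

/-! ### Formal series in `ℝ^d`

A formal series `∑_N t^N Y_N` is the sequence of its coefficients `Y : ℕ → E`. In a B-series the
formal variable `t` marks the order: the term of the tree `τ` belongs to `t^{2ρ(τ)}`. -/

section Formal

variable {E : Type*} [NormedAddCommGroup E] [NormedSpace ℝ E]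

/-- The coefficient of `t^N` in the Taylor expansion of `c` at `t = 0`. -/
noncomputable def taylorCoeff (c : ℝ → E) (N : ℕ) : E :=
  ((N.factorial : ℝ)⁻¹) • iteratedDeriv N c 0

/-- The polynomial curve `t ↦ ∑_{n ≤ N} t^n Y_n`. -/
noncomputable def truncCurve (Y : ℕ → E) (N : ℕ) (t : ℝ) : E :=
  ∑ n ∈ Finset.range (N + 1), t ^ n • Y n

/-- The formal series `f(Y)`, by Taylor expansion: its coefficient of `t^N` is that of
`f(∑_{n ≤ N} t^n Y_n)`. -/
noncomputable def formalEval (f : E → E) (Y : ℕ → E) (N : ℕ) : E :=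
  taylorCoeff (fun t => f (truncCurve Y N t)) N

/-- The formal series `f'(Y) V`. -/
noncomputable def formalDeriv (f : E → E) (Y V : ℕ → E) (N : ℕ) : E :=
  taylorCoeff (fun t => fderiv ℝ f (truncCurve Y N t) (truncCurve V N t)) N

variable {m : ℕ}

/-- The B-series `B(φ, x₀) = ∑_τ α(τ) φ(τ) F(τ)(x₀)` as a formal series: the coefficient of `t^N`
collects the trees of order `N / 2`. -/
noncomputable def bSeries (g : Fin (m + 1) → E → E) (φ : T m → ℝ) (x₀ : E) (N : ℕ) : E :=
  ∑ τ ∈ T.ofOrder2 m N, ((τ.alpha : ℝ) * φ τ) • τ.elemDiff g x₀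

/-- The B-series `B(φ, Y) = ∑_τ t^{2ρ(τ)} α(τ) φ(τ) F(τ)(Y)` evaluated at a formal series `Y`. -/
noncomputable def bSeriesAt (g : Fin (m + 1) → E → E) (φ : T m → ℝ) (Y : ℕ → E) (N : ℕ) : E :=
  ∑ q ∈ Finset.HasAntidiagonal.antidiagonal N, ∑ τ ∈ T.ofOrder2 m q.1,
    ((τ.alpha : ℝ) * φ τ) • formalEval (τ.elemDiff g) Y q.2

/-- `∂₂B(φ, Y) V = ∑_τ t^{2ρ(τ)} α(τ) φ(τ) F(τ)'(Y) V`, the Jacobian of `B(φ, ·)` at the formal series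
`Y` applied to the formal series `V`. -/
noncomputable def bSeriesDeriv (g : Fin (m + 1) → E → E) (φ : T m → ℝ) (Y V : ℕ → E) (N : ℕ) : E :=
  ∑ q ∈ Finset.HasAntidiagonal.antidiagonal N, ∑ τ ∈ T.ofOrder2 m q.1,
    ((τ.alpha : ℝ) * φ τ) • formalDeriv (τ.elemDiff g) Y V q.2

/-- `Y_0, Y_1, …` are the full Newton iterates with predictor `B(φ0, x₀)`:
`Y_{k+1} = B(φex, x₀) + B(φim, Y_k) + ∂₂B(φim, Y_k) (Y_{k+1} - Y_k)`. -/
def IsNewtonIterates (g : Fin (m + 1) → E → E) (φex φim φ0 : T m → ℝ) (x₀ : E)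
    (Y : ℕ → ℕ → E) : Prop :=
  Y 0 = bSeries g φ0 x₀ ∧
    ∀ k, Y (k + 1) = bSeries g φex x₀ + bSeriesAt g φim (Y k) +
      bSeriesDeriv g φim (Y k) (Y (k + 1) - Y k)

end Formal

end BSeries

/-!
Let `H` be the polynomial algebra in the nonempty trees and `B_l : H → H` the linear operator
grafting a forest onto a root of colour `l`. For a weight function `φ`, the algebra endomorphism
`cutHom φ` of `H` sends a tree to the sum of `φ(ω) ϑ` over its cuts `(ϑ, ω)`; the recursive definition
of the cuts says that `cutHom φ (B_l q) = φ(B_l q) + B_l (cutHom φ q)` (`cutHom_graft`). This identity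
yields associativity of the composition of weights (`comp_assoc`). It also yields the composition law
of B-series: the series `∑ α(τ) F(τ)(x) τ` over all trees is the only solution of the fixed point
equation `Z = x + ∑_l B_l (g_l(Z))`, and `cutHom φ` turns a solution at `x` into one at `B(φ, x)`
(`algSeries_comp`).

Newton's method enters through the dual numbers. The operation `∗` is the derivative of the
composition at the unit weight (`comp_perturb_unitWeight`), so that by associativity over the dual
numbers `Φ_k ∘ ((Φ_k⁻¹ ∘ Φ_{k+1}) ∗ Φ_im)` is the composition with `Φ_im`, linearised at `Φ_k` and
evaluated at `Φ_{k+1}` (`comp_star_comp_inv`). As `Φ_im(∅) = 0`, its value at a tree involves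
`Φ_{k+1}` only at smaller trees, which gives existence and uniqueness of the weights. Likewise,
`B(Φ_im, Y) + ∂₂B(Φ_im, Y) (Y' - Y)` is the composition of B-series over the dual numbers
(`bSeriesAt_add_bSeriesDeriv`). There the smooth vector fields may be replaced by polynomial ones,
since a coefficient of a formal series only depends on finitely many derivatives at `x₀`
(`exists_jetEq_polyMap`). Hence the Newton iterates are the B-series of the Newton weights
(`isNewtonIterates_iff`).

The linearised product over the remainder trees of a cut is exact if `Φ_k` and the solution agree on
all of them but one. In a cut of `τ` at most one remainder tree has the doubling index of `τ`
(`countDoubling_cut`), and so the doubling index is a growth function.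

For sharpness, let `Φ_ex = Φ_0 = e` and let `Φ_im` be `1` on single vertices and `0` elsewhere. Then
`Φ ≡ 1`, and the value of `Φ_{k+1}` at a tree is the product over its branches, linearised at `Φ_k`.
By convexity the iterates increase and stay below `1` until `k` reaches the doubling index
(`newton_strict`).
-/

namespace BSeries

/-! ### Cuts and composition as sums over multisets -/

section Cuts

variable {m : ℕ} {R : Type*} [CommRing R]

theorem Tree.cuts_eq (τ : Tree m) :
    τ.cuts = (none, {τ}) ::ₘ (Multiset.Sections (τ.children.map Tree.cuts)).map fun c =>
      (some (Tree.node τ.root (c.filterMap Prod.fst)), (c.map Prod.snd).sum) := by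
  rw [Tree.cuts, Multiset.attach_map_val' τ.children Tree.cuts]

/-- The product `∏_{δ ∈ ω} φ(δ)` over a multiset of nonempty trees. -/
def forestWeight (φ : T m → R) (ν : Multiset (Tree m)) : R := (ν.map fun δ => φ (some δ)).prod

@[simp] theorem forestWeight_zero (φ : T m → R) : forestWeight φ 0 = 1 := by simp [forestWeight]

@[simp] theorem forestWeight_cons (φ : T m → R) (a : Tree m) (ν : Multiset (Tree m)) :
    forestWeight φ (a ::ₘ ν) = φ (some a) * forestWeight φ ν := by simp [forestWeight]

@[simp] theorem forestWeight_add (φ : T m → R) (ν ν' : Multiset (Tree m)) :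
    forestWeight φ (ν + ν') = forestWeight φ ν * forestWeight φ ν' := by simp [forestWeight]

@[simp] theorem forestWeight_singleton (φ : T m → R) (a : Tree m) :
    forestWeight φ {a} = φ (some a) := by simp [forestWeight]

theorem forestWeight_congr {φ ψ : T m → R} {ν : Multiset (Tree m)}
    (h : ∀ δ ∈ ν, φ (some δ) = ψ (some δ)) : forestWeight φ ν = forestWeight ψ ν := by
  rw [forestWeight, forestWeight, Multiset.map_congr rfl h]

theorem map_forestWeight {S : Type*} [CommRing S] (f : R →+* S) (φ : T m → R)
    (ν : Multiset (Tree m)) :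
    f (forestWeight φ ν) = forestWeight (fun τ => f (φ τ)) ν := by
  simp [forestWeight, map_multiset_prod, Multiset.map_map]

/-- A sum over `ST(τ)` weighted with `γ` is a sum over all cuts. -/
theorem sum_ST (τ : T m) (f : T m × Multiset (Tree m) → R) :
    ∑ p ∈ τ.ST, (τ.gamma p : R) * f p = (τ.cuts.map f).sum := by
  classical
  rw [Finset.sum_multiset_map_count]
  simp only [T.ST, T.gamma, nsmul_eq_mul]

theorem comp_eq (φ ψ : T m → R) (τ : T m) :
    comp φ ψ τ = (τ.cuts.map fun p => ψ p.1 * forestWeight φ p.2).sum :=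
  sum_ST τ fun p => ψ p.1 * forestWeight φ p.2

@[simp] theorem comp_none (φ ψ : T m → R) : comp φ ψ none = ψ none := by
  simp [comp_eq, T.cuts]

theorem map_comp {S : Type*} [CommRing S] (f : R →+* S) (φ ψ : T m → R) (τ : T m) :
    f (comp φ ψ τ) = comp (fun σ => f (φ σ)) (fun σ => f (ψ σ)) τ := by
  rw [comp_eq, comp_eq, map_multiset_sum, Multiset.map_map]
  simp [map_forestWeight]

end Cuts

/-! ### The polynomial algebra of forests -/

section Forests

open MvPolynomial

variable {m : ℕ} {R : Type*} [CommRing R]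

/-- The tree `τ` as an element of the polynomial algebra in the nonempty trees; the empty tree is
the unit. -/
noncomputable def treeVar (R : Type*) [CommRing R] : T m → MvPolynomial (Tree m) R
  | none => 1
  | some τ => X τ

/-- The product of the trees of a multiset. -/
noncomputable def forest (R : Type*) [CommRing R] (s : Multiset (Tree m)) :
    MvPolynomial (Tree m) R := (s.map X).prod

theorem forest_eq_monomial (s : Multiset (Tree m)) [DecidableEq (Tree m)] :
    forest R s = monomial (Multiset.toFinsupp s) 1 := by
  induction s using Multiset.induction_on with
  | empty => simp [forest]
  | cons a s ih =>
    rw [forest] at ih ⊢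
    rw [Multiset.map_cons, Multiset.prod_cons, ih, ← Multiset.singleton_add, map_add,
      Multiset.toFinsupp_singleton, X, monomial_mul, one_mul]

theorem forest_toMultiset (s : Tree m →₀ ℕ) :
    forest R (Finsupp.toMultiset s) = monomial s 1 := by
  classical rw [forest_eq_monomial]; simp

theorem linearMap_ext_forest {M : Type*} [AddCommMonoid M] [Module R M]
    {f g : MvPolynomial (Tree m) R →ₗ[R] M} (h : ∀ s, f (forest R s) = g (forest R s)) :
    f = g := by
  refine (basisMonomials (Tree m) R).ext fun s => ?_
  simpa [forest_toMultiset] using h (Finsupp.toMultiset s)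

/-- The grafting operator: the linear map sending a forest `τ₁ ⋯ τ_κ` to the tree
`[τ₁, …, τ_κ]_l`. -/
noncomputable def graft (R : Type*) [CommRing R] (l : Fin (m + 1)) :
    MvPolynomial (Tree m) R →ₗ[R] MvPolynomial (Tree m) R :=
  (basisMonomials (Tree m) R).constr R fun s => X (Tree.node l (Finsupp.toMultiset s))

theorem graft_monomial (l : Fin (m + 1)) (s : Tree m →₀ ℕ) :
    graft R l (monomial s 1) = X (Tree.node l (Finsupp.toMultiset s)) := by
  have := (basisMonomials (Tree m) R).constr_basis R
    (fun s => (X (Tree.node l (Finsupp.toMultiset s)) : MvPolynomial (Tree m) R)) s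
  simpa [graft] using this

@[simp] theorem graft_forest (l : Fin (m + 1)) (s : Multiset (Tree m)) :
    graft R l (forest R s) = X (Tree.node l s) := by
  classical rw [forest_eq_monomial, graft_monomial, Multiset.toFinsupp_toMultiset]

open Classical in
/-- A weight function as a linear form on the polynomial algebra of forests, vanishing on products
of two or more trees. -/
noncomputable def weightForm (φ : T m → R) : MvPolynomial (Tree m) R →ₗ[R] R :=
  (basisMonomials (Tree m) R).constr R fun s =>
    if s = 0 then φ none else
      if h : ∃ τ, s = Finsupp.single τ 1 then φ (some h.choose) else 0

theorem weightForm_monomial (φ : T m → R) (s : Tree m →₀ ℕ) [Decidable (s = 0)]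
    [Decidable (∃ τ, s = Finsupp.single τ 1)] :
    weightForm φ (monomial s 1) = if s = 0 then φ none else
      if h : ∃ τ, s = Finsupp.single τ 1 then φ (some h.choose) else 0 := by
  classical
  have := (basisMonomials (Tree m) R).constr_basis R
    (fun s => if s = 0 then φ none else
      if h : ∃ τ, s = Finsupp.single τ 1 then φ (some h.choose) else 0) s
  rw [coe_basisMonomials] at this
  rw [weightForm]
  convert this

@[simp] theorem weightForm_one (φ : T m → R) : weightForm φ 1 = φ none := by
  classical
  have := weightForm_monomial φ (0 : Tree m →₀ ℕ)
  simpa using this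

@[simp] theorem weightForm_X (φ : T m → R) (τ : Tree m) : weightForm φ (X τ) = φ (some τ) := by
  classical
  have h : ∃ σ, Finsupp.single τ 1 = Finsupp.single σ (1 : ℕ) := ⟨τ, rfl⟩
  rw [X, weightForm_monomial, if_neg (by simp), dif_pos h]
  have := h.choose_spec
  rw [← Finsupp.single_left_injective one_ne_zero this]

@[simp] theorem weightForm_treeVar (φ : T m → R) (τ : T m) :
    weightForm φ (treeVar R τ) = φ τ := by
  cases τ <;> simp [treeVar]

/-- A weight function as an algebra homomorphism on forests; the value `φ(∅)` is replaced by
`1`. -/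
noncomputable def weightHom (φ : T m → R) : MvPolynomial (Tree m) R →ₐ[R] R :=
  aeval fun τ => φ (some τ)

@[simp] theorem weightHom_X (φ : T m → R) (τ : Tree m) : weightHom φ (X τ) = φ (some τ) := by
  simp [weightHom]

theorem weightHom_graft_eq (φ : T m → R) (l : Fin (m + 1)) (q : MvPolynomial (Tree m) R) :
    weightHom φ (graft R l q) = weightForm φ (graft R l q) := by
  have : (weightHom φ).toLinearMap ∘ₗ graft R l = weightForm φ ∘ₗ graft R l :=
    linearMap_ext_forest fun s => by simp
  exact LinearMap.congr_fun this q

/-- The substitution `τ ↦ ∑_{(ϑ, ω)} φ(ω) ϑ`, the sum running over all cuts of `τ`. -/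
noncomputable def cutHom (φ : T m → R) : MvPolynomial (Tree m) R →ₐ[R] MvPolynomial (Tree m) R :=
  aeval fun τ => (τ.cuts.map fun p => forestWeight φ p.2 • treeVar R p.1).sum

theorem cutHom_X (φ : T m → R) (τ : Tree m) :
    cutHom φ (X τ) = (τ.cuts.map fun p => forestWeight φ p.2 • treeVar R p.1).sum := by
  simp [cutHom]

theorem prod_sum_map_eq_sections {β A : Type*} [CommSemiring A] (f : β → A)
    (s : Multiset (Multiset β)) :
    (s.map fun b => (b.map f).sum).prod =
      ((Multiset.Sections s).map fun c => (c.map f).prod).sum := by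
  induction s using Multiset.induction_on with
  | empty => simp
  | cons b s ih =>
    simp [ih, Multiset.map_bind, Multiset.sum_map_mul_left, Multiset.sum_map_mul_right]

/-- The terms of a choice of one cut per branch multiply to the term of the cut of the whole tree
that they form. -/
theorem prod_cut_terms (φ : T m → R) (c : Multiset (T m × Multiset (Tree m))) :
    (c.map fun p => forestWeight φ p.2 • treeVar R p.1).prod =
      forestWeight φ (c.map Prod.snd).sum • forest R (c.filterMap Prod.fst) := by
  induction c using Multiset.induction_on with
  | empty => simp [forest]
  | cons a c ih =>
    obtain ⟨ϑ, ν⟩ := a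
    rw [Multiset.map_cons, Multiset.prod_cons, ih, Multiset.map_cons, Multiset.sum_cons,
      forestWeight_add, smul_mul_smul_comm]
    cases ϑ with
    | none => rw [Multiset.filterMap_cons_none _ _ rfl]; simp [treeVar]
    | some ϑ => rw [Multiset.filterMap_cons_some Prod.fst _ _ rfl]; simp [treeVar, forest]

/-- The cut substitution satisfies the cocycle identity
`cutHom φ (graft q) = φ(graft q) + graft (cutHom φ q)`. It encodes the recursive definition of the
cuts and is what every identity between compositions is derived from. -/
theorem cutHom_graft (φ : T m → R) (l : Fin (m + 1)) (q : MvPolynomial (Tree m) R) :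
    cutHom φ (graft R l q) = C (weightHom φ (graft R l q)) + graft R l (cutHom φ q) := by
  have : (cutHom φ).toLinearMap ∘ₗ graft R l =
      (Algebra.linearMap R (MvPolynomial (Tree m) R)) ∘ₗ (weightHom φ).toLinearMap ∘ₗ graft R l
        + graft R l ∘ₗ (cutHom φ).toLinearMap := by
    refine linearMap_ext_forest fun s => ?_
    simp only [LinearMap.comp_apply, LinearMap.add_apply, graft_forest, AlgHom.toLinearMap_apply,
      weightHom_X, Algebra.linearMap_apply]
    have h1 : cutHom φ (forest R s) = (s.map fun τ => cutHom φ (X τ)).prod := by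
      rw [forest, map_multiset_prod, Multiset.map_map]; rfl
    have h2 : (s.map fun τ => cutHom φ (X τ)).prod =
        ((Multiset.Sections (s.map Tree.cuts)).map fun c =>
          (c.map fun p => forestWeight φ p.2 • treeVar R p.1).prod).sum := by
      rw [← prod_sum_map_eq_sections, Multiset.map_map]
      simp only [cutHom_X, Function.comp_def]
    rw [h1, h2, map_multiset_sum, Multiset.map_map, cutHom_X, Tree.cuts_eq, Tree.root_node,
      Tree.children_node, Multiset.map_cons, Multiset.sum_cons, Multiset.map_map]
    congr 1
    · simp [treeVar, Algebra.smul_def]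
    · congr 1
      refine Multiset.map_congr rfl fun c _ => ?_
      simp only [Function.comp_apply, prod_cut_terms, map_smul, graft_forest]
      rw [treeVar]
  exact LinearMap.congr_fun this q

theorem weightForm_cutHom_X (φ ψ : T m → R) (τ : Tree m) :
    weightForm ψ (cutHom φ (X τ)) = comp φ ψ (some τ) := by
  rw [cutHom_X, map_multiset_sum, Multiset.map_map, comp_eq]
  simp [T.cuts, mul_comm]

theorem weightForm_cutHom_treeVar (φ ψ : T m → R) (τ : T m) :
    weightForm ψ (cutHom φ (treeVar R τ)) = comp φ ψ τ := by
  cases τ with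
  | none => simp [treeVar]
  | some τ => exact weightForm_cutHom_X φ ψ τ

/-- Two algebra homomorphisms on forests agree if they agree on a tree whenever they agree on its
branches. -/
theorem algHom_ext_tree {A : Type*} [CommSemiring A] [Algebra R A]
    {f g : MvPolynomial (Tree m) R →ₐ[R] A}
    (h : ∀ l s, f (forest R s) = g (forest R s) → f (X (Tree.node l s)) = g (X (Tree.node l s))) :
    f = g := by
  refine MvPolynomial.algHom_ext fun τ => ?_
  induction τ using Tree.induction_children with
  | h τ ih =>
    rw [← Tree.node_root_children τ]
    refine h _ _ ?_
    rw [forest, map_multiset_prod, map_multiset_prod, Multiset.map_map, Multiset.map_map]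
    exact congrArg _ (Multiset.map_congr rfl ih)

/-- Cutting twice is cutting once with the composed weights. By the cocycle identity both sides obey
the same recursion over the branches. -/
theorem cutHom_comp (φ ψ : T m → R) (hψ : ψ none = 1) :
    (cutHom ψ).comp (cutHom φ) = cutHom (comp φ ψ) := by
  refine algHom_ext_tree fun l s ih => ?_
  rw [AlgHom.comp_apply] at ih ⊢
  rw [← graft_forest, cutHom_graft, cutHom_graft, map_add, cutHom_graft, ih, ← add_assoc,
    weightHom_graft_eq ψ]
  congr 1
  rw [eq_sub_of_add_eq' (cutHom_graft φ l (forest R s)).symm, map_sub, graft_forest,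
    weightForm_cutHom_X, weightHom_X, weightHom_X, ← MvPolynomial.algebraMap_eq, AlgHom.commutes,
    Algebra.algebraMap_eq_smul_one, map_smul, weightForm_one, hψ]
  simp [algebraMap_eq, Algebra.smul_def]

theorem comp_assoc (φ ψ χ : T m → R) (hψ : ψ none = 1) (τ : T m) :
    comp φ (comp ψ χ) τ = comp (comp φ ψ) χ τ := by
  rw [← weightForm_cutHom_treeVar (comp φ ψ), ← cutHom_comp φ ψ hψ, AlgHom.comp_apply, comp_eq]
  cases τ with
  | none => simp [treeVar, T.cuts]
  | some τ =>
    rw [treeVar, cutHom_X, map_multiset_sum, map_multiset_sum, Multiset.map_map, Multiset.map_map]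
    simp [weightForm_cutHom_treeVar, T.cuts, mul_comm]

/-- Only the cut `(τ, ∅)` contributes to the composition with the zero weight. -/
theorem comp_zero_left (ψ : T m → R) (τ : T m) : comp (fun _ => 0) ψ τ = ψ τ := by
  have h : cutHom (m := m) (R := R) (fun _ => 0) = AlgHom.id R _ := by
    refine algHom_ext_tree fun l s ih => ?_
    rw [← graft_forest, cutHom_graft, ih]
    simp
  rw [← weightForm_cutHom_treeVar, h]
  simp

end Forests

section Inverse

variable {m : ℕ} {R : Type*} [CommRing R]

theorem comp_congr_left {φ φ' : T m → R} (h : ∀ τ, φ (some τ) = φ' (some τ)) (ψ : T m → R)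
    (τ : T m) : comp φ ψ τ = comp φ' ψ τ := by
  rw [comp_eq, comp_eq]
  refine congrArg _ (Multiset.map_congr rfl fun p _ => ?_)
  rw [forestWeight_congr fun δ _ => h δ]

theorem unitWeight_comp (ψ : T m → R) (τ : T m) : comp unitWeight ψ τ = ψ τ := by
  rw [← comp_zero_left ψ τ]
  exact comp_congr_left (fun _ => rfl) ψ τ

theorem comp_unitWeight (φ : T m → R) (hφ : φ none = 1) (τ : T m) :
    comp φ unitWeight τ = φ τ := by
  cases τ with
  | none => simp [hφ, unitWeight]
  | some τ =>
    rw [comp_eq, T.cuts, Tree.cuts_eq, Multiset.map_cons, Multiset.sum_cons, Multiset.map_map]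
    simp [unitWeight]

theorem comp_add_right (φ ψ ψ' : T m → R) (τ : T m) :
    comp φ (fun σ => ψ σ + ψ' σ) τ = comp φ ψ τ + comp φ ψ' τ := by
  simp [comp_eq, add_mul]

theorem comp_sub_right (φ ψ ψ' : T m → R) (τ : T m) :
    comp φ (fun σ => ψ σ - ψ' σ) τ = comp φ ψ τ - comp φ ψ' τ := by
  simp [comp_eq, sub_mul]

/-- A cut conserves the number of vertices. -/
theorem size_cut (τ : Tree m) : ∀ p ∈ τ.cuts, T.size p.1 + (p.2.map Tree.size).sum = τ.size := by
  induction τ using Tree.induction_children with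
  | h τ ih =>
    intro p hp
    rw [Tree.cuts_eq, Multiset.mem_cons] at hp
    rcases hp with rfl | hp
    · simp [T.size]
    · obtain ⟨c, hc, rfl⟩ := Multiset.mem_map.1 hp
      rw [Multiset.mem_sections, Multiset.rel_map_left] at hc
      rw [T.size, Tree.size_eq (Tree.node _ _), Tree.size_eq τ, Tree.children_node, add_assoc]
      congr 1
      generalize τ.children = s at ih hc
      clear hp
      induction hc with
      | zero => simp
      | @cons a b s c hab _ ih' =>
        have h1 := ih a (by simp) b hab
        have h2 := ih' fun x hx => ih x (by simp [hx])
        obtain ⟨ϑ, ν⟩ := b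
        cases ϑ with
        | none =>
          rw [Multiset.filterMap_cons_none _ _ rfl]
          simp only [T.size, Multiset.map_cons, Multiset.sum_cons] at h1 h2 ⊢
          rw [Multiset.map_add Tree.size, Multiset.sum_add]
          omega
        | some ϑ =>
          rw [Multiset.filterMap_cons_some Prod.fst _ _ rfl]
          simp only [T.size, Multiset.map_cons, Multiset.sum_cons] at h1 h2 ⊢
          rw [Multiset.map_add Tree.size, Multiset.sum_add]
          omega

theorem mem_ST {τ : T m} {p : T m × Multiset (Tree m)} : p ∈ τ.ST ↔ p ∈ τ.cuts := by
  simp [T.ST]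

theorem size_fst_lt_iff {τ : T m} {p : T m × Multiset (Tree m)} (hp : p ∈ τ.cuts) :
    p.1.size < τ.size ↔ p.2 ≠ 0 := by
  cases τ with
  | none => simp [T.cuts] at hp; simp [hp, T.size]
  | some τ =>
    have h := size_cut τ p hp
    rw [T.size, ← h]
    constructor
    · rintro h1 h2
      simp [h2] at h1
    · intro h1
      obtain ⟨a, ha⟩ := Multiset.exists_mem_of_ne_zero h1
      have h2 := Multiset.single_le_sum (s := p.2.map Tree.size) (fun _ _ => Nat.zero_le _) _
        (Multiset.mem_map_of_mem _ ha)
      have := a.size_pos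
      omega

open Classical in
/-- The composition with the term of the trivial cut `(τ, ∅)` split off. -/
theorem comp_eq_add_sum (φ ψ : T m → R) (τ : T m) :
    comp φ ψ τ = ψ τ + ∑ p ∈ τ.ST.filter fun p => p.1.size < τ.size,
      (τ.gamma p : R) * (ψ p.1 * (p.2.map fun δ => φ (some δ)).prod) := by
  have hz : ∀ χ : T m → R, comp χ ψ τ =
      (∑ p ∈ τ.ST.filter fun p => p.1.size < τ.size,
        (τ.gamma p : R) * (ψ p.1 * (p.2.map fun δ => χ (some δ)).prod)) +
      ∑ p ∈ τ.ST.filter fun p => ¬ p.1.size < τ.size,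
        (τ.gamma p : R) * (ψ p.1 * (p.2.map fun δ => χ (some δ)).prod) := fun χ => by
    rw [Finset.sum_filter_add_sum_filter_not, comp]
  rw [hz φ, ← comp_zero_left ψ τ, hz fun _ => 0, add_comm]
  congr 1
  rw [Finset.sum_eq_zero (s := τ.ST.filter fun p => p.1.size < τ.size), zero_add]
  · refine Finset.sum_congr rfl fun p hp => ?_
    rw [Finset.mem_filter, mem_ST] at hp
    have : p.2 = 0 := by
      by_contra h
      exact hp.2 ((size_fst_lt_iff hp.1).2 h)
    simp [this]
  · intro p hp
    rw [Finset.mem_filter, mem_ST] at hp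
    obtain ⟨a, ha⟩ := Multiset.exists_mem_of_ne_zero ((size_fst_lt_iff hp.1).1 hp.2)
    rw [Multiset.prod_eq_zero (Multiset.mem_map.2 ⟨a, ha, rfl⟩)]
    simp

theorem comp_inv (φ : T m → R) (τ : T m) : comp φ (inv φ) τ = unitWeight τ := by
  classical
  rw [comp_eq_add_sum, inv, ← Finset.sum_attach (τ.ST.filter _)]
  convert sub_add_cancel _ _

/-- The right inverse `φ⁻¹` of `φ` cancels under composition from the left. -/
theorem comp_comp_inv (φ ψ : T m → R) (τ : T m) : comp φ (comp (inv φ) ψ) τ = ψ τ := by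
  have h : comp φ (inv φ) = unitWeight := funext (comp_inv φ)
  have h1 : inv φ none = 1 := by rw [← comp_none φ (inv φ), h]; rfl
  rw [comp_assoc φ (inv φ) ψ h1, h, unitWeight_comp]

end Inverse

section Newton

variable {m : ℕ} {R : Type*} [CommRing R]

open TrivSqZeroExt

/-- The weight `φ + ε η` over the dual numbers. -/
def perturb (φ η : T m → R) (τ : T m) : DualNumber R := inl (φ τ) + inr (η τ)

theorem fst_forestWeight (f : T m → DualNumber R) (ν : Multiset (Tree m)) :
    (forestWeight f ν).fst = forestWeight (fun τ => (f τ).fst) ν :=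
  map_forestWeight (fstHom R R R).toRingHom f ν

/-- The linearisation at `φ` of the product `∏_{δ ∈ ω} φ(δ)`, evaluated at `ψ`:
`∏_δ φ(δ) + ∑_δ (ψ(δ) - φ(δ)) ∏_{δ' ≠ δ} φ(δ')`. These are the two components of the product of the
dual numbers `φ(δ) + ε (ψ(δ) - φ(δ))`. -/
noncomputable def linWeight (φ ψ : T m → R) (ν : Multiset (Tree m)) : R :=
  (forestWeight (perturb φ fun τ => ψ τ - φ τ) ν).fst +
    (forestWeight (perturb φ fun τ => ψ τ - φ τ) ν).snd

@[simp] theorem linWeight_zero (φ ψ : T m → R) : linWeight φ ψ 0 = 1 := by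
  simp [linWeight]

theorem linWeight_cons (φ ψ : T m → R) (a : Tree m) (ν : Multiset (Tree m)) :
    linWeight φ ψ (a ::ₘ ν) =
      φ (some a) * linWeight φ ψ ν + (ψ (some a) - φ (some a)) * forestWeight φ ν := by
  simp [linWeight, fst_forestWeight, perturb]
  ring

theorem fst_forestWeight_perturb (φ η : T m → R) (ν : Multiset (Tree m)) :
    (forestWeight (perturb φ η) ν).fst = forestWeight φ ν := by
  simp [fst_forestWeight, perturb]

theorem linWeight_congr {φ φ' ψ ψ' : T m → R} {ν : Multiset (Tree m)}
    (h : ∀ δ ∈ ν, φ (some δ) = φ' (some δ)) (h' : ∀ δ ∈ ν, ψ (some δ) = ψ' (some δ)) :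
    linWeight φ ψ ν = linWeight φ' ψ' ν := by
  rw [linWeight, linWeight, forestWeight_congr (φ := perturb φ _)
    (ψ := perturb φ' fun τ => ψ' τ - φ' τ) fun δ hδ => by simp only [perturb, h δ hδ, h' δ hδ]]

theorem linWeight_self (φ : T m → R) (ν : Multiset (Tree m)) :
    linWeight φ φ ν = forestWeight φ ν := by
  induction ν using Multiset.induction_on with
  | empty => simp
  | cons a ν ih => simp [linWeight_cons, ih]

/-- The composition with right argument `ψ`, linearised in its left argument at `φ` and evaluated at
`φ'`. -/
noncomputable def linComp (φ φ' ψ : T m → R) (τ : T m) : R :=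
  (τ.cuts.map fun p => ψ p.1 * linWeight φ φ' p.2).sum

theorem fst_multiset_sum (s : Multiset (DualNumber R)) : s.sum.fst = (s.map fst).sum :=
  map_multiset_sum (fstHom R R R) s

theorem snd_multiset_sum (s : Multiset (DualNumber R)) : s.sum.snd = (s.map snd).sum :=
  map_multiset_sum (sndHom R R) s

theorem fst_comp_perturb (φ η ψ : T m → R) (τ : T m) :
    (comp (perturb φ η) (fun σ => inl (ψ σ)) τ).fst = comp φ ψ τ := by
  rw [comp_eq, comp_eq, fst_multiset_sum, Multiset.map_map]
  refine congrArg _ (Multiset.map_congr rfl fun p _ => ?_)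
  simp [fst_forestWeight_perturb]

theorem linComp_eq (φ φ' ψ : T m → R) (τ : T m) :
    linComp φ φ' ψ τ = comp φ ψ τ +
      (comp (perturb φ fun σ => φ' σ - φ σ) (fun σ => inl (ψ σ)) τ).snd := by
  rw [comp_eq, comp_eq, snd_multiset_sum, Multiset.map_map, ← Multiset.sum_map_add, linComp]
  refine congrArg _ (Multiset.map_congr rfl fun p _ => ?_)
  simp [linWeight, fst_forestWeight_perturb, mul_add]

/-- The composition is linear in its right argument, so perturbing that argument perturbs the value
linearly. -/
theorem comp_inl_perturb (φ ψ η : T m → R) (τ : T m) :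
    comp (fun σ => inl (φ σ)) (perturb ψ η) τ = perturb (comp φ ψ) (comp φ η) τ := by
  have h : ∀ ν : Multiset (Tree m), forestWeight (fun σ => (inl (φ σ) : DualNumber R)) ν =
      inl (forestWeight φ ν) := fun ν => (map_forestWeight (inlHom R R) φ ν).symm
  refine TrivSqZeroExt.ext ?_ ?_
  · rw [comp_eq, fst_multiset_sum, Multiset.map_map]
    simp [h, perturb, comp_eq]
  · rw [comp_eq, snd_multiset_sum, Multiset.map_map]
    simp [h, perturb, comp_eq, mul_comm]

theorem forestWeight_inr (η : T m → R) (ν : Multiset (Tree m)) :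
    forestWeight (fun σ => (inr (η σ) : DualNumber R)) ν =
      if ν.card = 0 then 1 else if ν.card = 1 then inr (forestWeight η ν) else 0 := by
  induction ν using Multiset.induction_on with
  | empty => simp
  | cons a ν ih =>
    rw [forestWeight_cons, ih]
    rcases Nat.lt_trichotomy ν.card 1 with h | h | h
    · obtain rfl : ν = 0 := by simpa using h
      simp
    · simp [h]
    · have h0 : ν ≠ 0 := by rintro rfl; simp at h
      simp [h.ne', h0]

/-- The operation `∗` is the linearisation of the composition at the unit weight. -/
theorem comp_perturb_unitWeight (η ψ : T m → R) (τ : T m) :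
    comp (perturb unitWeight η) (fun σ => inl (ψ σ)) τ = perturb ψ (starAux η ψ) τ := by
  cases τ with
  | none => simp [perturb, starAux]
  | some τ =>
    have h : ∀ ν : Multiset (Tree m), forestWeight (perturb unitWeight η) ν =
        if ν.card = 0 then 1 else if ν.card = 1 then inr (forestWeight η ν) else 0 := fun ν => by
      rw [← forestWeight_inr]
      exact forestWeight_congr fun δ _ => by simp [perturb, unitWeight]
    refine TrivSqZeroExt.ext ?_ ?_
    · rw [fst_comp_perturb, unitWeight_comp]
      simp [perturb]
    · rw [comp_eq, snd_multiset_sum, Multiset.map_map]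
      simp only [perturb, snd_add, snd_inl, snd_inr, zero_add, starAux, T.SP, Finset.sum_filter]
      rw [← (sum_ST (some τ) _)]
      refine Finset.sum_congr rfl fun p _ => ?_
      simp only [Function.comp_apply, h]
      by_cases h0 : p.2.card = 0
      · simp [h0]
      · by_cases h1 : p.2.card = 1
        · simp [h1, forestWeight, mul_comm]
        · simp [h0, h1]

/-- The Newton step for weights only involves the linearised composition: the inverse and the
operation `∗` cancel against the outer composition. -/
theorem comp_star_comp_inv (φ ψ χ : T m → R) (hφ : φ none = 1) (hψ : ψ none = 1) (τ : T m) :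
    comp φ (star (comp (inv φ) ψ) χ) τ = linComp φ ψ χ τ := by
  set η : T m → R := fun σ => comp (inv φ) ψ σ - unitWeight σ with hη
  have hη0 : η none = 0 := by simp [hη, hψ, unitWeight]
  have hstar : star (comp (inv φ) ψ) χ = fun σ => starAux η χ σ + χ σ := by
    funext σ
    rw [star, comp_none, hψ, one_mul, hη]
    simp
  have hc : comp φ η = fun σ => ψ σ - φ σ := by
    funext σ
    rw [hη, comp_sub_right, comp_comp_inv, comp_unitWeight φ hφ]
  have h1 : comp (fun σ => inl (φ σ)) (perturb unitWeight η) = perturb φ fun σ => ψ σ - φ σ := by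
    funext σ
    rw [comp_inl_perturb, hc, funext (comp_unitWeight φ hφ)]
  -- Associativity for `φ`, `e + ε η` and `χ`: the left grouping gives `φ ∘ χ + ε φ ∘ (η ∗ χ)`, the
  -- right one composes the perturbation `φ + ε (ψ - φ)` of `φ` with `χ`.
  have h2 := comp_assoc (fun σ => (inl (φ σ) : DualNumber R)) (perturb unitWeight η)
    (fun σ => inl (χ σ)) (by simp [perturb, unitWeight, hη0]) τ
  rw [h1, funext (comp_perturb_unitWeight η χ), comp_inl_perturb] at h2
  rw [linComp_eq, ← h2, hstar, comp_add_right, add_comm]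
  simp [perturb]

end Newton
/-! ### Existence and uniqueness of the weight functions -/

section Existence

variable {m : ℕ} {R : Type*}

/-- Recursion on the number of vertices: an equation `φ(τ) = G(φ)(τ)` whose right-hand side only
depends on the values of `φ` at nonempty trees smaller than `τ` has exactly one solution. -/
theorem existsUnique_of_size_rec [Zero R] (G : (T m → R) → T m → R)
    (hG : ∀ φ φ' τ, (∀ δ : Tree m, δ.size < T.size τ → φ (some δ) = φ' (some δ)) →
      G φ τ = G φ' τ) :
    ∃! φ : T m → R, ∀ τ, φ τ = G φ τ := by
  have key : ∀ φ φ' : T m → R, ∀ N, (∀ τ, T.size τ < N → φ τ = φ' τ) →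
      ∀ τ, T.size τ < N + 1 → G φ τ = G φ' τ := fun φ φ' N h τ hτ =>
    hG φ φ' τ fun δ hδ => h (some δ) (lt_of_lt_of_le hδ (Nat.lt_succ_iff.1 hτ))
  -- The `n`-th Picard iterate is correct on trees with fewer than `n` vertices.
  let a : ℕ → T m → R := fun n => G^[n] 0
  have ha : ∀ n τ, T.size τ < n → a n τ = a (n + 1) τ := by
    intro n
    induction n with
    | zero => intro τ h; omega
    | succ n ih =>
      intro τ h
      simp only [a, Function.iterate_succ_apply'] at ih ⊢
      exact key _ _ n ih τ h
  have hb : ∀ k n τ, T.size τ < n → a (n + k) τ = a n τ := by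
    intro k n τ h
    induction k with
    | zero => rfl
    | succ k ih => rw [← ih, ← add_assoc, ha (n + k) τ (by omega)]
  refine ⟨fun τ => a (T.size τ + 1) τ, fun τ => ?_, fun φ hφ => ?_⟩
  · change G^[_] 0 τ = _
    rw [Function.iterate_succ_apply']
    refine hG _ _ _ fun δ hδ => ?_
    obtain ⟨k, hk⟩ := Nat.exists_eq_add_of_lt hδ
    have := hb k (T.size (some δ) + 1) (some δ) (by omega)
    rw [← this]
    simp only [T.size] at hk ⊢
    rw [hk, show δ.size + k + 1 = δ.size + 1 + k by omega]
  · have h2 : ∀ N τ, T.size τ < N → φ τ = a N τ := by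
      intro N
      induction N with
      | zero => intro τ h; omega
      | succ N ih =>
        intro τ h
        rw [hφ]
        simp only [a, Function.iterate_succ_apply'] at ih ⊢
        exact key _ _ N ih τ h
    exact funext fun τ => h2 _ τ (Nat.lt_succ_self _)

variable [CommRing R]

theorem size_lt_of_mem_cut {τ : T m} {p : T m × Multiset (Tree m)} (hp : p ∈ τ.cuts)
    (h : p.1 ≠ none) {δ : Tree m} (hδ : δ ∈ p.2) : δ.size < τ.size := by
  cases τ with
  | none => simp [T.cuts] at hp; exact absurd (by rw [hp]) h
  | some τ =>
    have h1 := size_cut τ p hp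
    have h2 := Multiset.single_le_sum (s := p.2.map Tree.size) (fun _ _ => Nat.zero_le _) _
        (Multiset.mem_map_of_mem _ hδ)
    obtain ⟨ϑ, hϑ⟩ := Option.ne_none_iff_exists'.1 h
    have := ϑ.size_pos
    rw [hϑ] at h1
    simp only [T.size] at h1 ⊢
    omega

/-- A sum over cuts weighted by a function vanishing at `∅` only involves the remainders that
consist of smaller trees. -/
theorem sum_cuts_congr {ψ : T m → R} (hψ : ψ none = 0) {f f' : Multiset (Tree m) → R} {τ : T m}
    (h : ∀ p ∈ τ.cuts, (∀ δ ∈ p.2, δ.size < τ.size) → f p.2 = f' p.2) :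
    (τ.cuts.map fun p => ψ p.1 * f p.2).sum = (τ.cuts.map fun p => ψ p.1 * f' p.2).sum := by
  refine congrArg _ (Multiset.map_congr rfl fun p hp => ?_)
  by_cases h0 : p.1 = none
  · rw [h0, hψ, zero_mul, zero_mul]
  · rw [h p hp fun δ hδ => size_lt_of_mem_cut hp h0 hδ]

variable {Φex Φim Φ0 : T m → R}

theorem existsUnique_methodWeight (hex : Φex none = 1) (him : Φim none = 0) :
    ∃! Φ : T m → R, IsMethodWeight Φex Φim Φ := by
  have h := existsUnique_of_size_rec (fun Φ τ => Φex τ + comp Φ Φim τ) fun φ φ' τ h => by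
    rw [comp_eq, comp_eq, sum_cuts_congr him fun p _ hs =>
      forestWeight_congr fun δ hδ => h δ (hs δ hδ)]
  refine (existsUnique_congr fun Φ => ?_).1 h
  refine ⟨fun hΦ => ⟨by rw [hΦ]; simp [hex, him], hΦ⟩, fun hΦ => hΦ.2⟩

theorem existsUnique_newtonStep (him : Φim none = 0) (φ : T m → R) :
    ∃! ψ : T m → R, ∀ τ, ψ τ = Φex τ + linComp φ ψ Φim τ :=
  existsUnique_of_size_rec (fun ψ τ => Φex τ + linComp φ ψ Φim τ) fun ψ ψ' τ h => by
    rw [linComp, linComp, sum_cuts_congr him fun p _ hs =>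
      linWeight_congr (fun _ _ => rfl) fun δ hδ => h δ (hs δ hδ)]

/-- The recursion of the Newton weights in terms of the linearised composition. -/
theorem isNewtonWeight_iff (hex : Φex none = 1) (him : Φim none = 0) (h0 : Φ0 none = 1)
    (Φs : ℕ → T m → R) : IsNewtonWeight Φex Φim Φ0 Φs ↔
      Φs 0 = Φ0 ∧ ∀ k τ, Φs (k + 1) τ = Φex τ + linComp (Φs k) (Φs (k + 1)) Φim τ := by
  constructor
  · rintro ⟨h, h'⟩
    have h1 : ∀ k, Φs k none = 1 := by
      rintro (_ | k)
      · rw [h, h0]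
      · exact (h' k).1
    exact ⟨h, fun k τ => by rw [(h' k).2, comp_star_comp_inv _ _ _ (h1 k) (h1 (k + 1))]⟩
  · rintro ⟨h, h'⟩
    have h1 : ∀ k, Φs k none = 1 := by
      rintro (_ | k)
      · rw [h, h0]
      · rw [h']; simp [linComp, T.cuts, hex, him]
    refine ⟨h, fun k => ⟨h1 (k + 1), fun τ => ?_⟩⟩
    rw [comp_star_comp_inv _ _ _ (h1 k) (h1 (k + 1)), ← h']

theorem existsUnique_newtonWeight (hex : Φex none = 1) (him : Φim none = 0) (h0 : Φ0 none = 1) :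
    ∃! Φs : ℕ → T m → R, IsNewtonWeight Φex Φim Φ0 Φs := by
  refine (existsUnique_congr fun Φs => (isNewtonWeight_iff hex him h0 Φs).symm).1 ?_
  choose next hnext huniq using fun φ : T m → R => existsUnique_newtonStep (Φex := Φex) him φ
  refine ⟨fun k => Nat.rec Φ0 (fun _ φ => next φ) k, ⟨rfl, fun k => hnext _⟩, ?_⟩
  rintro Φs ⟨h, h'⟩
  funext k
  induction k with
  | zero => exact h
  | succ k ih =>
    change Φs (k + 1) = next _
    rw [← ih]
    exact huniq _ _ (h' k)

theorem IsMethodWeight.map {S : Type*} [CommRing S] (f : R →+* S) {Φ : T m → R}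
    (h : IsMethodWeight Φex Φim Φ) :
    IsMethodWeight (fun τ => f (Φex τ)) (fun τ => f (Φim τ)) fun τ => f (Φ τ) :=
  ⟨by simp only [h.1, map_one], fun τ => by simp only [h.2 τ, map_add, map_comp]⟩

theorem map_linWeight {S : Type*} [CommRing S] (f : R →+* S) (φ ψ : T m → R)
    (ν : Multiset (Tree m)) :
    f (linWeight φ ψ ν) = linWeight (fun τ => f (φ τ)) (fun τ => f (ψ τ)) ν := by
  induction ν using Multiset.induction_on with
  | empty => simp
  | cons a ν ih => simp [linWeight_cons, ih, map_forestWeight]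

theorem map_linComp {S : Type*} [CommRing S] (f : R →+* S) (φ ψ χ : T m → R) (τ : T m) :
    f (linComp φ ψ χ τ) =
      linComp (fun τ => f (φ τ)) (fun τ => f (ψ τ)) (fun τ => f (χ τ)) τ := by
  rw [linComp, linComp, map_multiset_sum, Multiset.map_map]
  simp [map_linWeight]

end Existence

/-! ### The doubling index is a growth function -/

section Doubling

variable {m : ℕ} {R : Type*} [CommRing R]

theorem doubling_eq (τ : Tree m) :
    τ.doubling = if τ.children.map Tree.doubling = 0 then 1 else
      if 2 ≤ (τ.children.map Tree.doubling).count (τ.children.map Tree.doubling).sup then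
        (τ.children.map Tree.doubling).sup + 1 else (τ.children.map Tree.doubling).sup := by
  rw [Tree.doubling]
  simp only [Multiset.attach_map_val' τ.children Tree.doubling]

/-- The number of trees in a multiset of doubling index at least `n`. -/
noncomputable def countDoubling (n : ℕ) (ν : Multiset (Tree m)) : ℕ :=
  ν.countP fun δ => n ≤ δ.doubling

/-- By the definition of the doubling index, at most one branch has the index of the whole tree. -/
theorem countDoubling_children_le (τ : Tree m) : countDoubling τ.doubling τ.children ≤ 1 := by
  have h : ∀ n, countDoubling n τ.children =
      (τ.children.map Tree.doubling).countP fun x => n ≤ x := fun n => by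
    rw [countDoubling, Multiset.countP_map, Multiset.countP_eq_card_filter]
  rw [h, doubling_eq]
  generalize τ.children.map Tree.doubling = s
  split_ifs with h0 h1
  · simp [h0]
  · rw [Multiset.countP_eq_zero.2]
    · omega
    · intro x hx h2
      have := Multiset.le_sup hx
      omega
  · have : s.countP (fun x => s.sup ≤ x) = s.count s.sup :=
      Multiset.countP_congr rfl fun x hx =>
        propext ⟨fun h => le_antisymm h (Multiset.le_sup hx), fun h => h.le⟩
    omega

theorem doubling_child_le {τ c : Tree m} (h : c ∈ τ.children) : c.doubling ≤ τ.doubling := by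
  have h1 := Multiset.le_sup (Multiset.mem_map_of_mem Tree.doubling h)
  rw [doubling_eq τ, if_neg (by rw [Multiset.map_eq_zero]; rintro h0; simp [h0] at h)]
  split_ifs <;> omega

/-- Disjoint subtrees of `τ` have a doubling index of at most that of `τ`, and at most one of them
attains it. -/
theorem countDoubling_cut (τ : Tree m) : ∀ p ∈ τ.cuts, countDoubling τ.doubling p.2 ≤ 1 ∧
    ∀ δ ∈ p.2, δ.doubling ≤ τ.doubling := by
  induction τ using Tree.induction_children with
  | h τ ih =>
    intro p hp
    rw [Tree.cuts_eq, Multiset.mem_cons] at hp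
    rcases hp with rfl | hp
    · exact ⟨(Multiset.countP_le_card _ _).trans (by simp), by simp⟩
    · obtain ⟨c, hc, rfl⟩ := Multiset.mem_map.1 hp
      rw [Multiset.mem_sections, Multiset.rel_map_left] at hc
      have h1 : ∀ a ∈ τ.children, a.doubling ≤ τ.doubling := fun a => doubling_child_le
      suffices h : countDoubling τ.doubling (c.map Prod.snd).sum ≤
          countDoubling τ.doubling τ.children ∧
          ∀ δ ∈ (c.map Prod.snd).sum, δ.doubling ≤ τ.doubling from
        ⟨h.1.trans (countDoubling_children_le τ), h.2⟩
      generalize τ.doubling = d at h1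
      generalize τ.children = s at ih hc h1
      clear hp
      induction hc with
      | zero => simp
      | @cons a b s c hab _ ih' =>
        have h2 := ih a (by simp) b hab
        have h3 := h1 a (by simp)
        have h4 := ih' (fun x hx => ih x (by simp [hx])) fun x hx => h1 x (by simp [hx])
        rw [Multiset.map_cons, Multiset.sum_cons]
        refine ⟨?_, fun δ hδ => ?_⟩
        · rw [countDoubling, Multiset.countP_add, countDoubling, Multiset.countP_cons, add_comm]
          refine Nat.add_le_add h4.1 ?_
          split_ifs with h5
          · rw [le_antisymm h5 h3]
            exact h2.1
          · rw [Multiset.countP_eq_zero.2]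
            intro δ hδ h6
            have := h2.2 δ hδ
            omega
        · rcases Multiset.mem_add.1 hδ with hδ | hδ
          · exact (h2.2 δ hδ).trans h3
          · exact h4.2 δ hδ

/-- If `φ` and `ψ` agree on all trees of `ω` but at most one, the linearised product is exact. -/
theorem linWeight_eq_forestWeight {φ ψ : T m → R} {ν : Multiset (Tree m)} (P : Tree m → Prop)
    [DecidablePred P] (h : ν.countP P ≤ 1) (hP : ∀ δ ∈ ν, ¬ P δ → φ (some δ) = ψ (some δ)) :
    linWeight φ ψ ν = forestWeight ψ ν := by
  by_cases h0 : ∃ δ ∈ ν, P δ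
  · obtain ⟨δ, hδ, hPδ⟩ := h0
    obtain ⟨ν, rfl⟩ := Multiset.exists_cons_of_mem hδ
    have h1 : ∀ x ∈ ν, φ (some x) = ψ (some x) := fun x hx => hP x (by simp [hx]) fun hPx => by
      have := Multiset.countP_pos.2 ⟨x, hx, hPx⟩
      rw [Multiset.countP_cons_of_pos _ hPδ] at h
      omega
    rw [linWeight_cons, forestWeight_cons, linWeight_congr (φ' := ψ) (ψ' := ψ) h1 fun _ _ => rfl,
      linWeight_self, forestWeight_congr h1]
    ring
  · push Not at h0
    rw [linWeight_congr (φ' := ψ) (ψ' := ψ) (fun x hx => hP x hx (h0 x hx)) fun _ _ => rfl,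
      linWeight_self]

/-- The doubling index is a growth function. In each remainder of a tree of index at most `k + 1`, at
most one tree has index `k + 1`; on all others `Φ_k` is already exact, so that the linearised product
is, and the claim follows by induction on the size. -/
theorem isGrowthFunction_doubling {Φex Φim Φ : T m → R} {Φs : ℕ → T m → R} (him : Φim none = 0)
    (hΦ : IsMethodWeight Φex Φim Φ)
    (hΦs : ∀ k τ, Φs (k + 1) τ = Φex τ + linComp (Φs k) (Φs (k + 1)) Φim τ) :
    IsGrowthFunction T.doubling Φ Φs := by
  intro k hk τ hτ
  induction hn : τ.size using Nat.strong_induction_on generalizing τ with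
  | _ n ih =>
    rw [hΦs, hΦ.2, comp_eq, linComp]
    congr 1
    refine sum_cuts_congr him fun p hp hs => ?_
    have hd : countDoubling (k + 1) p.2 ≤ 1 ∧ ∀ δ ∈ p.2, δ.doubling ≤ k + 1 := by
      cases τ with
      | none => simp [T.cuts] at hp; simp [hp, countDoubling]
      | some τ =>
        have h1 := countDoubling_cut τ p hp
        simp only [T.doubling] at hτ
        refine ⟨le_trans ?_ h1.1, fun δ hδ => (h1.2 δ hδ).trans hτ⟩
        simp only [countDoubling, Multiset.countP_eq_card_filter]
        exact Multiset.card_le_card (Multiset.monotone_filter_right _ fun δ h => hτ.trans h)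
    have h2 : ∀ δ ∈ p.2, Φs (k + 1) (some δ) = Φ (some δ) := fun δ hδ =>
      ih δ.size (hn ▸ hs δ hδ) (some δ) (hd.2 δ hδ) rfl
    rw [← forestWeight_congr h2]
    refine linWeight_eq_forestWeight (fun δ => k + 1 ≤ δ.doubling) hd.1 fun δ hδ hlt => ?_
    rw [h2 δ hδ, hk (some δ) (by simp only [T.doubling]; omega)]

theorem doubling_pos (τ : Tree m) : 0 < τ.doubling := by
  induction τ using Tree.induction_children with
  | h τ ih =>
    by_cases h : τ.children = 0
    · rw [doubling_eq, h]; simp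
    · obtain ⟨c, hc⟩ := Multiset.exists_mem_of_ne_zero h
      exact (ih c hc).trans_le (doubling_child_le hc)

theorem eq_of_doubling_le {Φ : T m → R} {Φs : ℕ → T m → R} (hΦ : Φ none = 1)
    (h0 : Φs 0 none = 1) (h : IsGrowthFunction T.doubling Φ Φs) (k : ℕ) :
    ∀ τ, T.doubling τ ≤ k → Φs k τ = Φ τ := by
  induction k with
  | zero =>
    rintro (_ | τ) hτ
    · rw [hΦ, h0]
    · exact absurd hτ (by simpa [T.doubling] using (doubling_pos τ).ne')
  | succ k ih => exact h k ih

end Doubling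

/-! ### Sharpness of the doubling index -/

section Sharp

variable {m : ℕ}

/-- The weight function that is `1` on single vertices and `0` on all other trees. -/
noncomputable def vertexWeight (m : ℕ) (R : Type*) [CommRing R] : T m → R
  | none => 0
  | some τ => if τ.children.card = 0 then 1 else 0

theorem map_vertexWeight {R S : Type*} [CommRing R] [CommRing S] (f : R →+* S) (τ : T m) :
    f (vertexWeight m R τ) = vertexWeight m S τ := by
  cases τ <;> simp [vertexWeight, apply_ite f]

theorem map_unitWeight {R S : Type*} [CommRing R] [CommRing S] (f : R →+* S) (τ : T m) :
    f (unitWeight τ) = unitWeight τ := by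
  cases τ <;> simp [unitWeight]

open MvPolynomial in
/-- Composing with the weight of single vertices removes the root. -/
theorem comp_vertexWeight {R : Type*} [CommRing R] (φ : T m → R) (τ : Tree m) :
    comp φ (vertexWeight m R) (some τ) = forestWeight φ τ.children := by
  have h0 : ∀ l q, weightHom (m := m) (R := R) (fun _ => 0) (graft R l q) = 0 := fun l q => by
    have : (weightHom fun _ => 0).toLinearMap ∘ₗ graft R l = 0 :=
      linearMap_ext_forest fun s => by simp
    exact LinearMap.congr_fun this q
  have h1 : ∀ l q, weightForm (vertexWeight m R) (graft R l q) = weightHom (fun _ => 0) q :=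
      fun l q => by
    have : weightForm (vertexWeight m R) ∘ₗ graft R l = (weightHom fun _ => 0).toLinearMap :=
      linearMap_ext_forest fun s => by
        rcases Multiset.empty_or_exists_mem s with rfl | ⟨a, ha⟩
        · rw [LinearMap.comp_apply, graft_forest]
          simp [vertexWeight, forest]
        · obtain ⟨s, rfl⟩ := Multiset.exists_cons_of_mem ha
          rw [LinearMap.comp_apply, graft_forest]
          simp [vertexWeight, forest]
    exact LinearMap.congr_fun this q
  have h2 : (weightHom fun _ => 0).comp (cutHom φ) = weightHom φ :=
    algHom_ext_tree fun l s _ => by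
      rw [AlgHom.comp_apply, ← graft_forest, cutHom_graft, map_add, h0]
      simp [weightHom]
  rw [← weightForm_cutHom_X]
  conv_lhs => rw [← Tree.node_root_children τ, ← graft_forest]
  rw [cutHom_graft, map_add, h1, ← AlgHom.comp_apply, h2, ← algebraMap_eq,
    Algebra.algebraMap_eq_smul_one, map_smul, weightForm_one]
  simp [vertexWeight, forest, forestWeight, map_multiset_prod, Multiset.map_map]

theorem linComp_vertexWeight {R : Type*} [CommRing R] (φ ψ : T m → R) (τ : Tree m) :
    linComp φ ψ (vertexWeight m R) (some τ) = linWeight φ ψ τ.children := by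
  have : (fun σ => TrivSqZeroExt.inl (vertexWeight m R σ)) = vertexWeight m (DualNumber R) :=
    funext (map_vertexWeight (TrivSqZeroExt.inlHom R R))
  rw [linComp_eq, this, comp_vertexWeight, comp_vertexWeight, linWeight,
    fst_forestWeight_perturb]

variable {φ ψ : T m → ℝ} {ν : Multiset (Tree m)}

theorem forestWeight_nonneg (h : ∀ δ : Tree m, δ ∈ ν → 0 ≤ φ (some δ)) : 0 ≤ forestWeight φ ν :=
  Multiset.prod_nonneg fun _ hx => by
    obtain ⟨δ, hδ, rfl⟩ := Multiset.mem_map.1 hx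
    exact h δ hδ

theorem forestWeight_mono (h : ∀ δ : Tree m, δ ∈ ν → 0 ≤ φ (some δ))
    (h' : ∀ δ : Tree m, δ ∈ ν → φ (some δ) ≤ ψ (some δ)) :
    forestWeight φ ν ≤ forestWeight ψ ν :=
  Multiset.prod_map_le_prod_map₀ _ _ h h'

theorem forestWeight_le_one (h : ∀ δ : Tree m, δ ∈ ν → 0 ≤ φ (some δ))
    (h' : ∀ δ : Tree m, δ ∈ ν → φ (some δ) ≤ 1) : forestWeight φ ν ≤ 1 := by
  refine (forestWeight_mono (ψ := fun _ => 1) h h').trans ?_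
  simp [forestWeight]

theorem forestWeight_lt_one (h : ∀ δ : Tree m, δ ∈ ν → 0 ≤ φ (some δ))
    (h' : ∀ δ : Tree m, δ ∈ ν → φ (some δ) ≤ 1) {δ : Tree m} (hδ : δ ∈ ν) (hlt : φ (some δ) < 1) :
    forestWeight φ ν < 1 := by
  obtain ⟨ν, rfl⟩ := Multiset.exists_cons_of_mem hδ
  rw [forestWeight_cons]
  have h1 := forestWeight_le_one (fun x hx => h x (Multiset.mem_cons_of_mem hx))
    fun x hx => h' x (Multiset.mem_cons_of_mem hx)
  have h2 := forestWeight_nonneg fun x hx => h x (Multiset.mem_cons_of_mem hx)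
  nlinarith [h δ hδ]

theorem forestWeight_le_linWeight (h : ∀ δ : Tree m, δ ∈ ν → 0 ≤ φ (some δ))
    (h' : ∀ δ : Tree m, δ ∈ ν → φ (some δ) ≤ ψ (some δ)) :
    forestWeight φ ν ≤ linWeight φ ψ ν := by
  induction ν using Multiset.induction_on with
  | empty => simp
  | cons a ν ih =>
    simp only [Multiset.mem_cons, forall_eq_or_imp] at h h'
    rw [linWeight_cons, forestWeight_cons]
    have h1 := mul_le_mul_of_nonneg_left (ih h.2 h'.2) h.1
    have h2 := mul_nonneg (sub_nonneg.2 h'.1) (forestWeight_nonneg h.2)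
    linarith

/-- The linearisation at `φ` bounds the product at a larger weight from below, by convexity of the
product along increasing directions. -/
theorem linWeight_le_forestWeight (h : ∀ δ : Tree m, δ ∈ ν → 0 ≤ φ (some δ))
    (h' : ∀ δ : Tree m, δ ∈ ν → φ (some δ) ≤ ψ (some δ)) :
    linWeight φ ψ ν ≤ forestWeight ψ ν := by
  induction ν using Multiset.induction_on with
  | empty => simp
  | cons a ν ih =>
    simp only [Multiset.mem_cons, forall_eq_or_imp] at h h'
    rw [linWeight_cons, forestWeight_cons]
    have h1 := mul_le_mul_of_nonneg_left (ih h.2 h'.2) h.1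
    have h2 := mul_le_mul_of_nonneg_left (forestWeight_mono h.2 h'.2) (sub_nonneg.2 h'.1)
    linarith

theorem linWeight_mono_right {ψ' : T m → ℝ} (h : ∀ δ : Tree m, δ ∈ ν → 0 ≤ φ (some δ))
    (h' : ∀ δ : Tree m, δ ∈ ν → ψ (some δ) ≤ ψ' (some δ)) :
    linWeight φ ψ ν ≤ linWeight φ ψ' ν := by
  induction ν using Multiset.induction_on with
  | empty => simp
  | cons a ν ih =>
    simp only [Multiset.mem_cons, forall_eq_or_imp] at h h'
    rw [linWeight_cons, linWeight_cons]
    have h1 := mul_le_mul_of_nonneg_left (ih h.2 h'.2) h.1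
    have h2 := mul_le_mul_of_nonneg_right h'.1 (forestWeight_nonneg h.2)
    linarith

/-- If two factors of the product at `φ` are below `1`, the linearised product stays below `1`. -/
theorem linWeight_lt_one {a b : Tree m}
    (h : ∀ δ : Tree m, δ ∈ a ::ₘ b ::ₘ ν → 0 ≤ φ (some δ))
    (h' : ∀ δ : Tree m, δ ∈ a ::ₘ b ::ₘ ν → ψ (some δ) ≤ 1)
    (h1 : ∀ δ : Tree m, δ ∈ a ::ₘ b ::ₘ ν → φ (some δ) ≤ 1)
    (ha : φ (some a) < 1) (hb : φ (some b) < 1) :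
    linWeight φ ψ (a ::ₘ b ::ₘ ν) < 1 := by
  refine (linWeight_mono_right (ψ' := fun _ => 1) h h').trans_lt ?_
  simp only [Multiset.mem_cons, forall_eq_or_imp] at h h1
  have h2 : linWeight φ (fun _ => 1) (b ::ₘ ν) ≤ 1 := by
    refine (linWeight_le_forestWeight (by simpa using h.2) (by simpa using h1.2)).trans ?_
    simp [forestWeight]
  have h3 : forestWeight φ (b ::ₘ ν) < 1 := by
    refine forestWeight_lt_one (δ := b) ?_ ?_ (by simp) hb
    · simpa using h.2
    · simpa using h1.2
  rw [linWeight_cons]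
  nlinarith [h.1, h.2.1]

theorem lt_doubling {τ : Tree m} {k : ℕ} (h : k + 1 < τ.doubling) :
    (∃ c ∈ τ.children, k + 1 < c.doubling) ∨
      ∃ a b ν, τ.children = a ::ₘ b ::ₘ ν ∧ k < a.doubling ∧ k < b.doubling := by
  by_cases h0 : ∃ c ∈ τ.children, k + 1 < c.doubling
  · exact Or.inl h0
  right
  push Not at h0
  rw [doubling_eq] at h
  have hsup : (τ.children.map Tree.doubling).sup ≤ k + 1 :=
    Multiset.sup_le.2 fun x hx => by
      obtain ⟨c, hc, rfl⟩ := Multiset.mem_map.1 hx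
      exact h0 c hc
  split_ifs at h with h1 h2
  · omega
  · have hk : (τ.children.map Tree.doubling).sup = k + 1 := by omega
    rw [hk] at h2
    have pick : ∀ s : Multiset (Tree m), 0 < (s.map Tree.doubling).count (k + 1) →
        ∃ a t, s = a ::ₘ t ∧ a.doubling = k + 1 := fun s hs => by
      obtain ⟨a, ha, hak⟩ := Multiset.mem_map.1 (Multiset.count_pos.1 hs)
      obtain ⟨t, ht⟩ := Multiset.exists_cons_of_mem ha
      exact ⟨a, t, ht, hak⟩
    obtain ⟨a, t, ht, hak⟩ := pick τ.children (by omega)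
    rw [ht, Multiset.map_cons, hak, Multiset.count_cons_self] at h2
    obtain ⟨b, ν, hν, hbk⟩ := pick t (by omega)
    exact ⟨a, b, ν, by rw [ht, hν], by omega, by omega⟩
  · omega

/-- For the equation `Φ = e + Φ ∘ v` with `v` the weight of single vertices, the Newton weights
increase with `k`, stay in `[0, 1]`, and are still below `1` at all trees of index greater than `k`:
such a tree either has a branch of index greater than `k`, or two branches of index at least `k`, for
which the linearised product loses a quadratic term. -/
theorem newton_strict {Φs : ℕ → T m → ℝ} (h0 : Φs 0 = unitWeight)
    (h : ∀ k τ, Φs (k + 1) τ = unitWeight τ + linComp (Φs k) (Φs (k + 1)) (vertexWeight m ℝ) τ)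
    (k : ℕ) (τ : Tree m) (hk : k < τ.doubling) : Φs k (some τ) < 1 := by
  have hstep : ∀ k (τ : Tree m), Φs (k + 1) (some τ) =
      linWeight (Φs k) (Φs (k + 1)) τ.children := fun k τ => by
    rw [h, linComp_vertexWeight, unitWeight, zero_add]
  have hmono : ∀ k (τ : Tree m), 0 ≤ Φs k (some τ) ∧ Φs k (some τ) ≤ Φs (k + 1) (some τ) := by
    intro k
    induction k with
    | zero =>
      intro τ
      have h1 : ∀ τ : Tree m, Φs 0 (some τ) = 0 := fun τ => by rw [h0]; rfl
      refine ⟨(h1 τ).ge, ?_⟩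
      rw [h1]
      induction τ using Tree.induction_children with
      | h τ ih =>
        rw [hstep]
        exact (forestWeight_nonneg fun c _ => (h1 c).ge).trans
          (forestWeight_le_linWeight (fun c _ => (h1 c).ge) fun c hc => by rw [h1]; exact ih c hc)
    | succ k ihk =>
      intro τ
      refine ⟨(ihk τ).1.trans (ihk τ).2, ?_⟩
      induction τ using Tree.induction_children with
      | h τ ih =>
        rw [hstep (k + 1), hstep k]
        exact (linWeight_le_forestWeight (fun c _ => (ihk c).1) fun c _ => (ihk c).2).trans
          (forestWeight_le_linWeight (fun c _ => (ihk c).1.trans (ihk c).2) ih)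
  have hle : ∀ k (τ : Tree m), Φs k (some τ) ≤ 1 := by
    intro k τ
    refine (hmono k τ).2.trans ?_
    induction τ using Tree.induction_children with
    | h τ ih =>
      rw [hstep]
      exact (linWeight_le_forestWeight (fun c _ => (hmono k c).1) fun c _ => (hmono k c).2).trans
        (forestWeight_le_one (fun c _ => (hmono (k + 1) c).1) ih)
  induction k generalizing τ with
  | zero => rw [h0]; simp [unitWeight]
  | succ k ihk =>
    induction τ using Tree.induction_children with
    | h τ ih =>
      rw [hstep]
      -- Either a branch carries the strict inequality already, or two branches do for `Φ_k`.
      rcases lt_doubling hk with ⟨c, hc, hkc⟩ | ⟨a, b, ν, hν, ha, hb⟩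
      · exact (linWeight_le_forestWeight (fun c _ => (hmono k c).1)
          fun c _ => (hmono k c).2).trans_lt
          (forestWeight_lt_one (fun c _ => (hmono (k + 1) c).1) (fun c _ => hle (k + 1) c) hc
            (ih c hc hkc))
      · rw [hν]
        exact linWeight_lt_one (fun c _ => (hmono k c).1) (fun c _ => hle (k + 1) c)
          (fun c _ => hle k c) (ihk a ha) (ihk b hb)

theorem methodWeight_vertexWeight {Φ : T m → ℝ}
    (h : IsMethodWeight unitWeight (vertexWeight m ℝ) Φ) (τ : T m) : Φ τ = 1 := by
  cases τ with
  | none => exact h.1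
  | some τ =>
    induction τ using Tree.induction_children with
    | h τ ih =>
      rw [h.2, comp_vertexWeight, forestWeight_congr (ψ := fun _ => 1) ih]
      simp [forestWeight, unitWeight]

end Sharp

/-! ### B-series of polynomial vector fields over a commutative ring -/

section Polynomial

open MvPolynomial

variable {ι S : Type*} [CommRing S] {m : ℕ}

/-- The derivative of a polynomial in the constant direction `v`. -/
noncomputable def dirDeriv (v : ι → S) : Derivation S (MvPolynomial ι S) (MvPolynomial ι S) :=
  mkDerivation S fun j => C (v j)

@[simp] theorem dirDeriv_X (v : ι → S) (j : ι) : dirDeriv v (X j) = C (v j) :=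
  mkDerivation_X _ _ _

theorem dirDeriv_comm (v w : ι → S) (q : MvPolynomial ι S) :
    dirDeriv v (dirDeriv w q) = dirDeriv w (dirDeriv v q) := by
  have h : ⁅dirDeriv v, dirDeriv w⁆ = 0 := by
    refine MvPolynomial.derivation_ext fun j => ?_
    simp [Derivation.commutator_apply]
  have := congrArg (fun D => D q) h
  simpa [Derivation.commutator_apply, sub_eq_zero] using this

theorem dirDeriv_smul (a : S) (v : ι → S) (q : MvPolynomial ι S) :
    dirDeriv (a • v) q = a • dirDeriv v q := by
  have h : dirDeriv (a • v) = a • dirDeriv v := by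
    refine MvPolynomial.derivation_ext fun j => ?_
    simp [smul_eq_C_mul]
  rw [h]; rfl

instance : LeftCommutative fun (v : ι → S) (q : MvPolynomial ι S) => dirDeriv v q :=
  ⟨fun v w q => dirDeriv_comm v w q⟩

/-- The iterated derivative of a polynomial in constant directions. -/
noncomputable def iterDeriv (s : Multiset (ι → S)) (q : MvPolynomial ι S) : MvPolynomial ι S :=
  s.foldr (fun v q => dirDeriv v q) q

@[simp] theorem iterDeriv_cons (v : ι → S) (s : Multiset (ι → S)) (q : MvPolynomial ι S) :
    iterDeriv (v ::ₘ s) q = dirDeriv v (iterDeriv s q) := Multiset.foldr_cons _ _ _ _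

theorem iterDeriv_dirDeriv (v : ι → S) (s : Multiset (ι → S)) (q : MvPolynomial ι S) :
    iterDeriv s (dirDeriv v q) = dirDeriv v (iterDeriv s q) := by
  induction s using Multiset.induction_on with
  | empty => rfl
  | cons w s ih => rw [iterDeriv_cons, iterDeriv_cons, ih, dirDeriv_comm]

theorem iterDeriv_map_smul {β : Type*} (a : β → S) (v : β → ι → S) (s : Multiset β)
    (q : MvPolynomial ι S) :
    iterDeriv (s.map fun c => a c • v c) q = (s.map a).prod • iterDeriv (s.map v) q := by
  induction s using Multiset.induction_on with
  | empty => simp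
  | cons b s ih =>
    rw [Multiset.map_cons, iterDeriv_cons, ih, dirDeriv_smul, Derivation.map_smul, smul_smul]
    simp

theorem map_iterDeriv {S' : Type*} [CommRing S'] (f : S →+* S') (s : Multiset (ι → S))
    (q : MvPolynomial ι S) :
    map f (iterDeriv s q) = iterDeriv (s.map fun v j => f (v j)) (map f q) := by
  have h : ∀ (v : ι → S) q, map f (dirDeriv v q) = dirDeriv (fun j => f (v j)) (map f q) := by
    intro v q
    induction q using MvPolynomial.induction_on with
    | C a => simp
    | add p q hp hq => simp [hp, hq]
    | mul_X p j hp => simp [hp, Derivation.leibniz]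
  induction s using Multiset.induction_on with
  | empty => rfl
  | cons v s ih => simp [h, ih]

/-- The elementary differential of a tree at the point `Y ∈ S^ι`, for polynomial vector fields
`p_l` over the ring `S`. -/
noncomputable def algDiff (p : Fin (m + 1) → ι → MvPolynomial ι S) (Y : ι → S) (τ : Tree m) :
    ι → S := fun i =>
  eval Y (iterDeriv (τ.children.attach.map fun c => algDiff p Y c.1) (p τ.root i))
termination_by τ.size
decreasing_by exact Tree.size_lt c.2

theorem algDiff_eq (p : Fin (m + 1) → ι → MvPolynomial ι S) (Y : ι → S) (τ : Tree m) (i : ι) :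
    algDiff p Y τ i = eval Y (iterDeriv (τ.children.map (algDiff p Y)) (p τ.root i)) := by
  rw [algDiff, Multiset.attach_map_val' τ.children (algDiff p Y)]

theorem map_algDiff {S' : Type*} [CommRing S'] (f : S →+* S')
    (p : Fin (m + 1) → ι → MvPolynomial ι S) (Y : ι → S) (τ : Tree m) (i : ι) :
    f (algDiff p Y τ i) = algDiff (fun l i => map f (p l i)) (fun j => f (Y j)) τ i := by
  induction τ using Tree.induction_children generalizing i with
  | h τ ih =>
    rw [algDiff_eq, algDiff_eq, map_eval, map_iterDeriv, Multiset.map_map]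
    refine congrArg (fun s => eval _ (iterDeriv s _)) (Multiset.map_congr rfl fun c hc => ?_)
    exact funext (ih c hc)

open Classical in
/-- The product `r₁! ⋯ r_q!` of the factorials of the multiplicities in a multiset. -/
noncomputable def multFactorial {β : Type*} (s : Multiset β) : ℕ :=
  ∏ c ∈ s.toFinset, (s.count c).factorial

open Classical in
theorem multFactorial_cons {β : Type*} (a : β) (s : Multiset β) :
    multFactorial (a ::ₘ s) = (s.count a + 1) * multFactorial s := by
  have h : ∀ (s : Multiset β) (W : Finset β), s.toFinset ⊆ W →
      multFactorial s = ∏ c ∈ W, (s.count c).factorial := by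
    intro s W hW
    rw [multFactorial]
    refine Finset.prod_subset hW fun c _ hc => ?_
    rw [Multiset.count_eq_zero.2 (by simpa using hc), Nat.factorial_zero]
  have ha : a ∈ (a ::ₘ s).toFinset := by simp
  rw [h (a ::ₘ s) _ subset_rfl, h s (a ::ₘ s).toFinset (by intro x; simp +contextual),
    ← Finset.mul_prod_erase _ _ ha, ← Finset.mul_prod_erase _ _ ha, Multiset.count_cons_self,
    Nat.factorial_succ, mul_assoc]
  congr 2
  refine Finset.prod_congr rfl fun c hc => ?_
  rw [Multiset.count_cons_of_ne (Finset.ne_of_mem_erase hc)]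

open Classical in
/-- The coefficients of `q(Y + ∑_τ v_τ X_τ)` are the derivatives of `q` in the directions `v_τ`, up
to factorials. -/
theorem coeff_aeval_mul_multFactorial {β : Type*} (Y : ι → S) (v : β → ι → S)
    (Z : ι → MvPolynomial β S) (hZ0 : ∀ j, constantCoeff (Z j) = Y j)
    (hZ : ∀ b j, pderiv b (Z j) = C (v b j)) (s : Multiset β) (q : MvPolynomial ι S) :
    coeff (Multiset.toFinsupp s) (aeval Z q) * multFactorial s =
      eval Y (iterDeriv (s.map v) q) := by
  have hchain : ∀ b (q : MvPolynomial ι S),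
      pderiv b (aeval Z q) = aeval Z (dirDeriv (v b) q) := by
    intro b q
    induction q using MvPolynomial.induction_on with
    | C a => simp
    | add p q hp hq => simp only [map_add, hp, hq]
    | mul_X p j hp =>
      simp only [map_add, map_mul, aeval_X, Derivation.leibniz, smul_eq_mul, dirDeriv_X, hp, hZ,
        aeval_C, algebraMap_eq]
  induction s using Multiset.induction_on generalizing q with
  | empty =>
    have : (constantCoeff.comp (aeval Z : MvPolynomial ι S →ₐ[S] MvPolynomial β S).toRingHom) =
        (eval Y) := by
      refine MvPolynomial.ringHom_ext (fun a => ?_) fun j => ?_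
      · simp
      · simp [hZ0]
    have := congrArg (fun f => f q) this
    simpa [multFactorial, constantCoeff_eq, iterDeriv] using this
  | cons a s ih =>
    have h := ih (dirDeriv (v a) q)
    rw [← hchain, coeff_pderiv, iterDeriv_dirDeriv] at h
    rw [Multiset.map_cons, iterDeriv_cons, ← h, multFactorial_cons, ← Multiset.singleton_add,
      map_add, Multiset.toFinsupp_singleton, add_comm]
    push_cast
    rw [Multiset.toFinsupp_apply]
    ring

end Polynomial

section FixedPoint

open MvPolynomial

variable {ι S : Type*} [CommRing S] {m : ℕ}

theorem C_dvd_graft {a : S} {q : MvPolynomial (Tree m) S} (l : Fin (m + 1)) (h : C a ∣ q) :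
    C a ∣ graft S l q := by
  obtain ⟨r, rfl⟩ := h
  exact ⟨graft S l r, by rw [← smul_eq_C_mul, map_smul, smul_eq_C_mul]⟩

open Classical in
theorem coeff_graft_single (l : Fin (m + 1)) (σ : Tree m) (q : MvPolynomial (Tree m) S) :
    coeff (Finsupp.single σ 1) (graft S l q) =
      if σ.root = l then coeff (Multiset.toFinsupp σ.children) q else 0 := by
  have : lcoeff S (Finsupp.single σ 1) ∘ₗ graft S l =
      if σ.root = l then lcoeff S (Multiset.toFinsupp σ.children) else 0 := by
    refine linearMap_ext_forest fun s => ?_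
    have hs : Finsupp.single (Tree.node l s) 1 = Finsupp.single σ (1 : ℕ) ↔ σ.root = l ∧
        Multiset.toFinsupp s = Multiset.toFinsupp σ.children := by
      rw [(Finsupp.single_left_injective one_ne_zero).eq_iff, EmbeddingLike.apply_eq_iff_eq]
      constructor
      · rintro rfl; simp
      · rintro ⟨rfl, rfl⟩; simp
    rw [LinearMap.comp_apply, graft_forest, lcoeff_apply, coeff_X]
    by_cases h : σ.root = l
    · rw [if_pos h, lcoeff_apply, forest_eq_monomial, coeff_monomial]
      simp only [hs, h, true_and]
    · rw [if_neg h, if_neg fun h' => h (hs.1 h').1]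
      rfl
  have := LinearMap.congr_fun this q
  split_ifs at this ⊢ <;> simpa using this

theorem coeff_graft_of_ne (l : Fin (m + 1)) (e : Tree m →₀ ℕ) (he : ∀ σ, e ≠ Finsupp.single σ 1)
    (q : MvPolynomial (Tree m) S) : coeff e (graft S l q) = 0 := by
  classical
  have : lcoeff S e ∘ₗ graft S l = 0 := by
    refine linearMap_ext_forest fun s => ?_
    simp [coeff_X, (he _).symm]
  exact LinearMap.congr_fun this q

theorem aeval_sub_aeval_dvd {A : Type*} [CommRing A] [Algebra S A] {a : A} {Z Z' : ι → A}
    (h : ∀ j, a ∣ Z j - Z' j) (q : MvPolynomial ι S) : a ∣ aeval Z q - aeval Z' q := by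
  induction q using MvPolynomial.induction_on with
  | C a => simp
  | add p q hp hq => simpa [add_sub_add_comm] using dvd_add hp hq
  | mul_X p j hp =>
    have e : aeval Z (p * X j) - aeval Z' (p * X j) =
        (aeval Z p - aeval Z' p) * Z j + aeval Z' p * (Z j - Z' j) := by
      rw [map_mul, map_mul, aeval_X, aeval_X]
      ring
    rw [e]
    exact dvd_add (hp.mul_right _) ((h j).mul_left _)

/-- The weight of a root of colour `l` in twice the order. -/
def colorWeight (l : Fin (m + 1)) : ℕ := if l = 0 then 2 else 1

theorem colorWeight_pos (l : Fin (m + 1)) : 0 < colorWeight l := by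
  rw [colorWeight]; split_ifs <;> omega

theorem finite_order2_le (N : ℕ) : {τ : Tree m | τ.order2 ≤ N}.Finite :=
  (Tree.finite_size_le N).subset fun τ h => (Tree.size_le_order2 τ).trans h

/-- The nonempty trees of order at most `N / 2`. -/
noncomputable def treesLE (m N : ℕ) : Finset (Tree m) := (finite_order2_le (m := m) N).toFinset

@[simp] theorem mem_treesLE {N : ℕ} {τ : Tree m} : τ ∈ treesLE m N ↔ τ.order2 ≤ N := by
  simp [treesLE]

/-- A fixed point of `Z = Y + ∑_l t^{w_l} graft_l (p_l(Z))` up to terms divisible by `t^n`, where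
`w_l` is `2` for `l = 0` and `1` otherwise. -/
def IsTreeFixedPoint (p : Fin (m + 1) → ι → MvPolynomial ι S) (t : S) (n : ℕ) (Y : ι → S)
    (Z : ι → MvPolynomial (Tree m) S) : Prop :=
  ∀ j, C (t ^ n) ∣ Z j - (C (Y j) + ∑ l, C (t ^ colorWeight l) * graft S l (aeval Z (p l j)))

/-- Every application of the fixed point equation gains a factor `t`. -/
theorem IsTreeFixedPoint.unique {p : Fin (m + 1) → ι → MvPolynomial ι S} {t : S} {n : ℕ}
    {Y : ι → S} {Z Z' : ι → MvPolynomial (Tree m) S} (h : IsTreeFixedPoint p t n Y Z)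
    (h' : IsTreeFixedPoint p t n Y Z') (j : ι) : C (t ^ n) ∣ Z j - Z' j := by
  suffices H : ∀ k ≤ n, ∀ j, C (t ^ k) ∣ Z j - Z' j from H n le_rfl j
  intro k
  induction k with
  | zero => simp
  | succ k ih =>
    intro hk j
    have h1 := ih (by omega)
    have hd : (C (t ^ (k + 1)) : MvPolynomial (Tree m) S) ∣ C (t ^ n) :=
      map_dvd C (pow_dvd_pow t hk)
    have h2 := hd.trans (dvd_sub (h j) (h' j))
    have h3 : C (t ^ (k + 1)) ∣ ∑ l, C (t ^ colorWeight l) * graft S l (aeval Z (p l j)) -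
        ∑ l, C (t ^ colorWeight l) * graft S l (aeval Z' (p l j)) := by
      rw [← Finset.sum_sub_distrib]
      refine Finset.dvd_sum fun l _ => ?_
      rw [← mul_sub, ← map_sub, pow_succ', map_mul]
      refine mul_dvd_mul (map_dvd C (dvd_pow_self t (colorWeight_pos l).ne')) ?_
      exact C_dvd_graft l (aeval_sub_aeval_dvd h1 _)
    have := dvd_add h2 h3
    ring_nf at this ⊢
    exact this

/-- Cutting trees turns a fixed point at `x` into a fixed point at the point `Y` that the
B-series with weights `φ` assigns to `x`. -/
theorem IsTreeFixedPoint.cutHom {p : Fin (m + 1) → ι → MvPolynomial ι S} {t : S} {n : ℕ}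
    {x : ι → S} {Z : ι → MvPolynomial (Tree m) S} (h : IsTreeFixedPoint p t n x Z) (φ : T m → S) :
    IsTreeFixedPoint p t n (fun j => weightHom φ (Z j)) fun j => cutHom φ (Z j) := by
  intro j
  obtain ⟨r, hr⟩ := h j
  rw [sub_eq_iff_eq_add'] at hr
  refine ⟨BSeries.cutHom φ r - C (weightHom φ r), ?_⟩
  have hC : ∀ (f : MvPolynomial (Tree m) S →ₐ[S] MvPolynomial (Tree m) S) (a : S),
      f (C a) = C a := fun f a => by rw [← algebraMap_eq, AlgHom.commutes]
  have hW : ∀ a : S, weightHom φ (C a) = a := fun a => by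
    rw [← algebraMap_eq, AlgHom.commutes]; rfl
  have e1 : ∀ l, BSeries.cutHom φ (aeval Z (p l j)) =
      aeval (fun j => BSeries.cutHom φ (Z j)) (p l j) := fun l => by
    rw [← AlgHom.comp_apply, comp_aeval]
  simp only
  rw [hr]
  simp only [map_add, map_sum, map_mul, hC, hW, cutHom_graft, e1, mul_add, Finset.sum_add_distrib]
  ring

end FixedPoint

section Composition

open MvPolynomial

variable {ι S : Type*} [CommRing S] [Algebra ℚ S] {m : ℕ}

/-- The coefficient `α(τ) t^{2ρ(τ)}` of the elementary differential of `τ`. -/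
noncomputable def treeCoeff (t : S) (τ : Tree m) : S := algebraMap ℚ S τ.alpha * t ^ τ.order2

theorem alpha_eq (τ : Tree m) : τ.alpha =
    (multFactorial τ.children : ℚ)⁻¹ * (τ.children.map Tree.alpha).prod := by
  rw [Tree.alpha, Multiset.attach_map_val' τ.children Tree.alpha, multFactorial]
  push_cast
  rfl

theorem treeCoeff_eq (t : S) (τ : Tree m) : treeCoeff t τ * multFactorial τ.children =
    t ^ colorWeight τ.root * (τ.children.map (treeCoeff t)).prod := by
  have h : ∀ s : Multiset (Tree m), (s.map (treeCoeff t)).prod =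
      algebraMap ℚ S (s.map Tree.alpha).prod * t ^ (s.map Tree.order2).sum := by
    intro s
    induction s using Multiset.induction_on with
    | empty => simp
    | cons a s ih => simp [ih, treeCoeff, pow_add]; ring
  have hne : (multFactorial τ.children : ℚ) ≠ 0 := by
    classical
    rw [multFactorial]
    exact_mod_cast Finset.prod_ne_zero_iff.2 fun c _ => Nat.factorial_ne_zero _
  have h1 : algebraMap ℚ S τ.alpha * (multFactorial τ.children : S) =
      algebraMap ℚ S (τ.children.map Tree.alpha).prod := by
    rw [alpha_eq, ← map_natCast (algebraMap ℚ S), ← map_mul]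
    congr 1
    field_simp
  rw [h, ← h1, treeCoeff, Tree.order2_eq, pow_add]
  simp only [colorWeight]
  ring

/-- The B-series with the trees themselves as weights, truncated at order `N / 2`. -/
noncomputable def treeSeries (p : Fin (m + 1) → ι → MvPolynomial ι S) (t : S) (N : ℕ) (Y : ι → S)
    (j : ι) : MvPolynomial (Tree m) S :=
  C (Y j) + ∑ τ ∈ treesLE m N, C (treeCoeff t τ * algDiff p Y τ j) * X τ

/-- The B-series with weights `φ` of polynomial vector fields, truncated at order `N / 2`. -/
noncomputable def algSeries (p : Fin (m + 1) → ι → MvPolynomial ι S) (t : S) (N : ℕ) (φ : T m → S)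
    (Y : ι → S) (j : ι) : S :=
  φ none * Y j + ∑ τ ∈ treesLE m N, treeCoeff t τ * algDiff p Y τ j * φ (some τ)

/-- The series of all trees solves the fixed point equation: by Taylor's formula the coefficient of
`τ₁ ⋯ τ_κ` in `p_l(Z)` is, up to the factorials in `α`, the elementary differential of
`[τ₁, …, τ_κ]_l`. -/
theorem isTreeFixedPoint_treeSeries (p : Fin (m + 1) → ι → MvPolynomial ι S) (t : S) (N : ℕ)
    (Y : ι → S) : IsTreeFixedPoint p t (N + 1) Y (treeSeries p t N Y) := by
  classical
  intro j
  rw [C_dvd_iff_dvd_coeff]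
  intro e
  rw [treeSeries, add_sub_add_left_eq_sub, coeff_sub, coeff_sum, coeff_sum]
  simp only [coeff_C_mul]
  by_cases he : ∃ σ, e = Finsupp.single σ 1
  swap
  · push Not at he
    rw [Finset.sum_eq_zero fun τ _ => by rw [coeff_X, if_neg (he τ).symm, mul_zero],
      Finset.sum_eq_zero fun l _ => by rw [coeff_graft_of_ne l e he, mul_zero], sub_zero]
    exact dvd_zero _
  obtain ⟨σ, rfl⟩ := he
  -- Trees outside the truncation carry the coefficient zero, so that the coefficient formula
  -- applies to all branches of `σ`.
  set a : Tree m → S := fun τ => if τ ∈ treesLE m N then treeCoeff t τ else 0 with ha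
  have hc := coeff_aeval_mul_multFactorial Y (fun τ => a τ • algDiff p Y τ) (treeSeries p t N Y)
    (fun j => by simp [treeSeries]) (fun b j => by
      simp only [treeSeries, map_add, map_sum, pderiv_C, pderiv_C_mul, pderiv_X, zero_add, ha]
      simp [Pi.single_apply]
      split_ifs <;> simp) σ.children (p σ.root j)
  rw [iterDeriv_map_smul, smul_eval, ← algDiff_eq] at hc
  have h1 : ∑ τ ∈ treesLE m N, treeCoeff t τ * algDiff p Y τ j *
      coeff (Finsupp.single σ 1) (X τ : MvPolynomial (Tree m) S) = a σ * algDiff p Y σ j := by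
    simp only [coeff_X, (Finsupp.single_left_injective (α := Tree m) (one_ne_zero (α := ℕ))).eq_iff]
    simp [ha]
  have h2 : ∑ l, t ^ colorWeight l * coeff (Finsupp.single σ 1)
      (graft S l (aeval (treeSeries p t N Y) (p l j))) = t ^ colorWeight σ.root *
        coeff (Multiset.toFinsupp σ.children) (aeval (treeSeries p t N Y) (p σ.root j)) := by
    simp [coeff_graft_single]
  have hord := Tree.order2_eq σ
  have hunit : IsUnit (multFactorial σ.children : S) := by
    have hne : (multFactorial σ.children : ℚ) ≠ 0 := by
      rw [multFactorial]
      exact_mod_cast Finset.prod_ne_zero_iff.2 fun c _ => Nat.factorial_ne_zero _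
    simpa using (IsUnit.mk0 _ hne).map (algebraMap ℚ S)
  change _ ∣ ∑ τ ∈ treesLE m N, treeCoeff t τ * algDiff p Y τ j *
      coeff (Finsupp.single σ 1) (X τ : MvPolynomial (Tree m) S) - ∑ l, t ^ colorWeight l *
      coeff (Finsupp.single σ 1) (graft S l (aeval (treeSeries p t N Y) (p l j)))
  rw [h1, h2, ← hunit.dvd_mul_right, sub_mul, mul_assoc (t ^ _), hc]
  by_cases hall : ∀ c ∈ σ.children, c ∈ treesLE m N
  · have h3 : (σ.children.map a).prod = (σ.children.map (treeCoeff t)).prod :=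
      congrArg _ (Multiset.map_congr rfl fun c hc => by rw [ha]; simp only [if_pos (hall c hc)])
    have h4 := treeCoeff_eq t σ
    rw [h3, ← mul_assoc, ← h4]
    by_cases hσ : σ ∈ treesLE m N
    · rw [ha]
      simp only [if_pos hσ]
      convert dvd_zero _
      ring
    · rw [ha]
      simp only [if_neg hσ, treeCoeff]
      rw [mem_treesLE, not_le] at hσ
      obtain ⟨k, hk⟩ := pow_dvd_pow t hσ
      exact ⟨-(algebraMap ℚ S σ.alpha * k * multFactorial σ.children * algDiff p Y σ j), by
        rw [Nat.succ_eq_add_one] at hk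
        rw [hk]; ring⟩
  · push Not at hall
    obtain ⟨c, hcσ, hcN⟩ := hall
    have hle := Multiset.single_le_sum (s := σ.children.map Tree.order2) (fun _ _ => Nat.zero_le _)
      _ (Multiset.mem_map_of_mem _ hcσ)
    have hσ : σ ∉ treesLE m N := by
      rw [mem_treesLE] at hcN ⊢
      omega
    rw [Multiset.prod_eq_zero (Multiset.mem_map.2 ⟨c, hcσ, if_neg hcN⟩), ha]
    simp [hσ]

/-- The composition of truncated B-series is the truncated B-series of the composition. The
substitution `cutHom φ` maps the series of trees at `x` to a solution of the fixed point equation at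
the point with B-series `φ`, hence to the series of trees there; evaluating the trees with `ψ` gives
the claim. -/
theorem algSeries_comp (p : Fin (m + 1) → ι → MvPolynomial ι S) (t : S) (N : ℕ) (φ ψ : T m → S)
    (hφ : φ none = 1) (x : ι → S) (j : ι) :
    t ^ (N + 1) ∣ algSeries p t N (comp φ ψ) x j - algSeries p t N ψ (algSeries p t N φ x) j := by
  have hx := (isTreeFixedPoint_treeSeries p t N x).cutHom φ
  have hY : (fun j => weightHom φ (treeSeries p t N x j)) = algSeries p t N φ x := by
    funext j
    simp [treeSeries, algSeries, hφ, weightHom]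
  rw [hY] at hx
  obtain ⟨r, hr⟩ := hx.unique (isTreeFixedPoint_treeSeries p t N (algSeries p t N φ x)) j
  have hC : ∀ (f : MvPolynomial (Tree m) S →ₐ[S] MvPolynomial (Tree m) S) (a : S),
      f (C a) = C a := fun f a => by rw [← algebraMap_eq, AlgHom.commutes]
  have hL : ∀ (χ : T m → S) (a : S), weightForm χ (C a) = a * χ none := fun χ a => by
    rw [← mul_one (C a), ← smul_eq_C_mul, map_smul, weightForm_one, smul_eq_mul]
  have hψ := congrArg (weightForm ψ) hr
  rw [← smul_eq_C_mul, map_smul, map_sub, smul_eq_mul] at hψ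
  refine ⟨weightForm ψ r, hψ ▸ ?_⟩
  have hCX : ∀ a τ, BSeries.cutHom φ (C a * X τ) = C a * BSeries.cutHom φ (X τ) := fun a τ => by
    rw [map_mul, hC]
  have hLX : ∀ a q, weightForm ψ (C a * q) = a * weightForm ψ q := fun a q => by
    rw [← smul_eq_C_mul, map_smul, smul_eq_mul]
  simp only [treeSeries, map_add, map_sum, hC, hCX, hL, hLX, weightForm_X, weightForm_cutHom_X]
  rw [algSeries, algSeries, comp_none]
  ring

end Composition
/-! ### Jets of smooth functions -/

section Jets

universe u

variable {E E' F G : Type u} [NormedAddCommGroup E] [NormedSpace ℝ E] [NormedAddCommGroup E']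
  [NormedSpace ℝ E'] [NormedAddCommGroup F] [NormedSpace ℝ F] [NormedAddCommGroup G]
  [NormedSpace ℝ G]

/-- Two smooth functions have the same derivatives up to order `n` at `x`, expressed by the vanishing
of the derivatives of their difference. -/
structure JetEq (n : ℕ) (f f' : E → F) (x : E) : Prop where
  contDiff_left : ContDiff ℝ ∞ f
  contDiff_right : ContDiff ℝ ∞ f'
  flat : ∀ k ≤ n, iteratedFDeriv ℝ k (fun y => f y - f' y) x = 0

theorem JetEq.refl {f : E → F} (hf : ContDiff ℝ ∞ f) (n : ℕ) (x : E) : JetEq n f f x :=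
  ⟨hf, hf, fun k _ => by simp⟩

theorem JetEq.mono {n n' : ℕ} {f f' : E → F} {x : E} (h : JetEq n f f' x) (hn : n' ≤ n) :
    JetEq n' f f' x :=
  ⟨h.1, h.2, fun k hk => h.3 k (hk.trans hn)⟩

theorem JetEq.contDiff_sub {n : ℕ} {f f' : E → F} {x : E} (h : JetEq n f f' x) :
    ContDiff ℝ ∞ fun y => f y - f' y := h.1.sub h.2

theorem JetEq.iteratedFDeriv_eq {n : ℕ} {f f' : E → F} {x : E} (h : JetEq n f f' x) {k : ℕ}
    (hk : k ≤ n) : iteratedFDeriv ℝ k f x = iteratedFDeriv ℝ k f' x := by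
  have : _root_.iteratedFDeriv ℝ k (f - f') x = 0 := h.3 k hk
  rw [iteratedFDeriv_sub_apply (h.1.contDiffAt.of_le (mod_cast le_top))
    (h.2.contDiffAt.of_le (mod_cast le_top))] at this
  exact sub_eq_zero.1 this

theorem JetEq.eq {n : ℕ} {f f' : E → F} {x : E} (h : JetEq n f f' x) : f x = f' x := by
  have := h.3 0 (Nat.zero_le _)
  rw [← norm_eq_zero, norm_iteratedFDeriv_zero, norm_eq_zero] at this
  exact sub_eq_zero.1 this

theorem JetEq.clm_comp {n : ℕ} {f f' : E → F} {x : E} (h : JetEq n f f' x) (L : F →L[ℝ] G) :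
    JetEq n (fun y => L (f y)) (fun y => L (f' y)) x := by
  refine ⟨L.contDiff.comp h.1, L.contDiff.comp h.2, fun k hk => ?_⟩
  have := L.iteratedFDeriv_comp_left (h.contDiff_sub.contDiffAt (x := x)) (i := k)
    (mod_cast le_top)
  rw [h.3 k hk] at this
  simp only [Function.comp_def, map_sub] at this
  rw [this]
  ext
  simp

/-- By the Leibniz bound, `f(y) v(y)` is flat at `x` as soon as one of the factors is. -/
theorem flat_clm_apply {n : ℕ} {f : E → F →L[ℝ] G} {v : E → F} {x : E} (hf : ContDiff ℝ ∞ f)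
    (hv : ContDiff ℝ ∞ v) (h : (∀ k ≤ n, iteratedFDeriv ℝ k f x = 0) ∨
      ∀ k ≤ n, iteratedFDeriv ℝ k v x = 0) :
    ∀ k ≤ n, iteratedFDeriv ℝ k (fun y => f y (v y)) x = 0 := by
  intro k hk
  rw [← norm_le_zero_iff]
  refine (norm_iteratedFDeriv_clm_apply hf hv x (mod_cast le_top)).trans ?_
  refine Finset.sum_nonpos fun i hi => ?_
  rw [Finset.mem_range] at hi
  rcases h with h | h
  · rw [h i (by omega)]; simp
  · rw [h (k - i) (by omega)]; simp

theorem JetEq.clm_apply {n : ℕ} {f f' : E → F →L[ℝ] G} {v v' : E → F} {x : E}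
    (h : JetEq n f f' x) (hv : JetEq n v v' x) :
    JetEq n (fun y => f y (v y)) (fun y => f' y (v' y)) x := by
  refine ⟨h.1.clm_apply hv.1, h.2.clm_apply hv.2, fun k hk => ?_⟩
  have e : (fun y => f y (v y) - f' y (v' y)) =
      (fun y => (f y - f' y) (v y)) + fun y => f' y (v y - v' y) := by
    funext y
    simp
  have c1 := h.contDiff_sub.clm_apply hv.1
  have c2 := h.2.clm_apply hv.contDiff_sub
  rw [e, iteratedFDeriv_add_apply (c1.contDiffAt.of_le (mod_cast le_top))
      (c2.contDiffAt.of_le (mod_cast le_top)),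
    flat_clm_apply h.contDiff_sub hv.1 (Or.inl h.3) k hk,
    flat_clm_apply h.2 hv.contDiff_sub (Or.inr hv.3) k hk, add_zero]

theorem JetEq.comp_right {n : ℕ} {f f' : E → F} {c : E' → E} {a : E'} (hc : ContDiff ℝ ∞ c)
    (h : JetEq n f f' (c a)) : JetEq n (fun y => f (c y)) (fun y => f' (c y)) a := by
  refine ⟨h.1.comp hc, h.2.comp hc, fun k hk => ?_⟩
  rw [← norm_le_zero_iff]
  set D : ℝ := 1 + ∑ i ∈ Finset.range (k + 1), ‖iteratedFDeriv ℝ i c a‖ with hD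
  have h1 : 0 ≤ ∑ i ∈ Finset.range (k + 1), ‖iteratedFDeriv ℝ i c a‖ :=
    Finset.sum_nonneg fun _ _ => norm_nonneg _
  refine (norm_iteratedFDeriv_comp_le (g := fun y => f y - f' y) (C := 0) (D := D)
    h.contDiff_sub hc (mod_cast le_top) a (fun i hi => ?_) fun i hi hi' => ?_).trans (by simp)
  · rw [h.3 i (hi.trans hk), norm_zero]
  · have h2 := Finset.single_le_sum (f := fun i => ‖iteratedFDeriv ℝ i c a‖)
      (fun _ _ => norm_nonneg _) (Finset.mem_range.2 (Nat.lt_succ_of_le hi'))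
    calc ‖iteratedFDeriv ℝ i c a‖ ≤ D := by rw [hD]; exact h2.trans (by linarith)
      _ ≤ D ^ i := le_self_pow₀ (by linarith) (by omega)

theorem JetEq.fderiv {n : ℕ} {f f' : E → F} {x : E} (h : JetEq (n + 1) f f' x) :
    JetEq n (fderiv ℝ f) (fderiv ℝ f') x := by
  refine ⟨h.1.fderiv_right (by simp), h.2.fderiv_right (by simp), fun k hk => ?_⟩
  have e : (fun y => _root_.fderiv ℝ f y - _root_.fderiv ℝ f' y) =
      _root_.fderiv ℝ fun y => f y - f' y := by
    funext y
    rw [fderiv_fun_sub (h.1.differentiable (by simp) y) (h.2.differentiable (by simp) y)]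
  rw [e, ← norm_eq_zero, norm_iteratedFDeriv_fderiv, h.3 (k + 1) (by omega), norm_zero]

theorem JetEq.iteratedFDeriv {n : ℕ} {f f' : E → F} {x : E} (k : ℕ) (h : JetEq (n + k) f f' x) :
    JetEq n (iteratedFDeriv ℝ k f) (iteratedFDeriv ℝ k f') x := by
  induction k generalizing n with
  | zero =>
    exact h.clm_comp (continuousMultilinearCurryFin0 ℝ E F).symm.toLinearIsometry.toContinuousLinearMap
  | succ k ih =>
    have h1 := (ih (n := n + 1) (by rwa [add_assoc, add_comm 1])).fderiv
    exact h1.clm_comp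
      (continuousMultilinearCurryLeftEquiv ℝ (fun _ : Fin (k + 1) => E)
        F).symm.toLinearIsometry.toContinuousLinearMap

theorem JetEq.multilinear_apply {n k : ℕ} {M M' : E → E' [×k]→L[ℝ] F} {v v' : Fin k → E → E'}
    {x : E} (h : JetEq n M M' x) (hv : ∀ i, JetEq n (v i) (v' i) x) :
    JetEq n (fun y => M y fun i => v i y) (fun y => M' y fun i => v' i y) x := by
  induction k with
  | zero =>
    have := h.clm_comp
      (continuousMultilinearCurryFin0 ℝ E' F).toLinearIsometry.toContinuousLinearMap
    convert this using 2 with y y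
    · exact congrArg (M y) (Subsingleton.elim _ _)
    · exact congrArg (M' y) (Subsingleton.elim _ _)
  | succ k ih =>
    have h1 := (h.clm_comp (continuousMultilinearCurryLeftEquiv ℝ (fun _ : Fin (k + 1) => E')
      F).toLinearIsometry.toContinuousLinearMap).clm_apply (hv 0)
    have h2 := ih h1 fun i => hv i.succ
    convert h2 using 2 with y y
    · change _ = M y (Fin.cons (v 0 y) fun i => v i.succ y)
      congr 1
      funext i
      refine Fin.cases ?_ (fun i => ?_) i <;> simp
    · change _ = M' y (Fin.cons (v' 0 y) fun i => v' i.succ y)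
      congr 1
      funext i
      refine Fin.cases ?_ (fun i => ?_) i <;> simp

theorem JetEq.elemDiff {m n : ℕ} {g g' : Fin (m + 1) → E → E} {x : E} (τ : Tree m)
    (h : ∀ l, JetEq (n + τ.size) (g l) (g' l) x) :
    JetEq n (τ.elemDiff g) (τ.elemDiff g') x := by
  induction τ using Tree.induction_children with
  | h τ ih =>
    have e : ∀ g : Fin (m + 1) → E → E, τ.elemDiff g = fun x =>
        _root_.iteratedFDeriv ℝ τ.children.toList.length (g τ.root) x
          (fun i => Tree.elemDiff g (τ.children.toList.get i) x) := fun g => by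
      funext x
      rw [Tree.elemDiff]
    rw [e, e]
    have hlen : τ.children.toList.length ≤ τ.size := by
      rw [Multiset.length_toList, Tree.size_eq]
      have h1 : (τ.children.map fun _ => 1).sum ≤ (τ.children.map Tree.size).sum :=
        Multiset.sum_map_le_sum_map _ _ fun c _ => c.size_pos
      simp only [Multiset.map_const', Multiset.sum_replicate, smul_eq_mul, mul_one] at h1
      omega
    refine JetEq.multilinear_apply (((h _).mono (by omega)).iteratedFDeriv _) fun i => ?_
    have hi : τ.children.toList.get i ∈ τ.children := Multiset.mem_toList.1 (List.get_mem _ _)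
    exact ih _ hi fun l => (h l).mono (by have := Tree.size_lt hi; omega)

/-- The derivative of a smooth function in the constant directions of a list. -/
noncomputable def listDeriv (f : E → F) : List E → E → F
  | [] => f
  | v :: L => fun x => _root_.fderiv ℝ (listDeriv f L) x v

theorem contDiff_listDeriv {f : E → F} (hf : ContDiff ℝ ∞ f) (L : List E) :
    ContDiff ℝ ∞ (listDeriv f L) := by
  induction L with
  | nil => exact hf
  | cons v L ih => exact (ih.fderiv_right (by simp)).clm_apply contDiff_const

theorem iteratedFDeriv_eq_listDeriv {f : E → F} (hf : ContDiff ℝ ∞ f) (n : ℕ) (x : E)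
    (v : Fin n → E) : _root_.iteratedFDeriv ℝ n f x v = listDeriv f (List.ofFn v) x := by
  induction n generalizing x with
  | zero => simp [listDeriv]
  | succ n ih =>
    have hd : DifferentiableAt ℝ (_root_.iteratedFDeriv ℝ n f) x :=
      (hf.iteratedFDeriv_right (m := ∞) (by exact_mod_cast le_top)).differentiable (by simp) x
    rw [hd.iteratedFDeriv_succ_apply_left', List.ofFn_succ, listDeriv]
    congr 2
    funext y
    exact ih y _

theorem listDeriv_perm {f : E → F} (hf : ContDiff ℝ ∞ f) {L L' : List E} (h : L.Perm L') :
    listDeriv f L = listDeriv f L' := by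
  induction h with
  | nil => rfl
  | cons v _ ih => simp only [listDeriv, ih]
  | swap v w L =>
    funext x
    have hc := contDiff_listDeriv hf L
    have hs := (hc.contDiffAt (x := x)).isSymmSndFDerivAt (by simp; norm_cast)
    have hd : DifferentiableAt ℝ (_root_.fderiv ℝ (listDeriv f L)) x :=
      (hc.fderiv_right (m := ∞) (by simp)).differentiable (by simp) x
    simp only [listDeriv]
    rw [fderiv_clm_apply hd (differentiableAt_const _),
      fderiv_clm_apply hd (differentiableAt_const _)]
    simpa using hs w v
  | trans _ _ ih ih' => exact ih.trans ih'

/-- The derivatives of a smooth function are symmetric. -/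
theorem iteratedFDeriv_comp_perm {f : E → F} (hf : ContDiff ℝ ∞ f) {n : ℕ} (x : E)
    (v : Fin n → E) (σ : Equiv.Perm (Fin n)) :
    (_root_.iteratedFDeriv ℝ n f x fun i => v (σ i)) = _root_.iteratedFDeriv ℝ n f x v := by
  rw [iteratedFDeriv_eq_listDeriv hf, iteratedFDeriv_eq_listDeriv hf]
  exact congrFun (listDeriv_perm hf (σ.ofFn_comp_perm v)) x

/-- The Taylor polynomial of degree `n` has the same jet. -/
theorem jetEq_taylor [CompleteSpace F] {f : E → F} (hf : ContDiff ℝ ∞ f) (n : ℕ) (x : E) :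
    JetEq n f (fun y => ∑ k ∈ Finset.range (n + 1),
      ((k.factorial : ℝ)⁻¹) • _root_.iteratedFDeriv ℝ k f x fun _ => y - x) x := by
  let P : FormalMultilinearSeries ℝ E F := fun k =>
    if k < n + 1 then ((k.factorial : ℝ)⁻¹) • _root_.iteratedFDeriv ℝ k f x else 0
  have hP : ∀ k, n + 1 ≤ k → P k = 0 := fun k hk => if_neg (by omega)
  have hfun : (fun y => ∑ k ∈ Finset.range (n + 1),
      ((k.factorial : ℝ)⁻¹) • _root_.iteratedFDeriv ℝ k f x fun _ => y - x) =
      fun y => P.sum (y - x) := by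
    funext y
    rw [P.sum_of_finite hP, FormalMultilinearSeries.partialSum]
    refine Finset.sum_congr rfl fun k hk => ?_
    simp only [P, if_pos (Finset.mem_range.1 hk)]
    rfl
  have hps := ((P.hasFiniteFPowerSeriesOnBall_of_finite hP).comp_sub x).toHasFPowerSeriesOnBall
  rw [zero_add] at hps
  have hsmooth : ContDiff ℝ ∞ fun y => ∑ k ∈ Finset.range (n + 1),
      ((k.factorial : ℝ)⁻¹) • _root_.iteratedFDeriv ℝ k f x fun _ => y - x := by
    refine ContDiff.sum fun k _ => contDiff_const.smul ?_
    exact (ContinuousMultilinearMap.contDiff _).comp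
      (contDiff_pi.2 fun _ => contDiff_id.sub contDiff_const)
  refine ⟨hf, hsmooth, fun k hk => ?_⟩
  change _root_.iteratedFDeriv ℝ k (f - fun y => ∑ k ∈ Finset.range (n + 1),
      ((k.factorial : ℝ)⁻¹) • _root_.iteratedFDeriv ℝ k f x fun _ => y - x) x = 0
  rw [iteratedFDeriv_sub_apply (hf.contDiffAt.of_le (mod_cast le_top))
    (hsmooth.contDiffAt.of_le (mod_cast le_top)), sub_eq_zero]
  ext v
  rw [hfun, hps.iteratedFDeriv_eq_sum_of_completeSpace]
  have : ∀ σ : Equiv.Perm (Fin k), (P k fun i => v (σ i)) =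
      ((k.factorial : ℝ)⁻¹) • _root_.iteratedFDeriv ℝ k f x v := fun σ => by
    simp only [P, if_pos (Nat.lt_succ_of_le hk)]
    rw [← iteratedFDeriv_comp_perm hf x v σ]
    rfl
  simp only [this, Finset.sum_const, Finset.card_univ, Fintype.card_perm, Fintype.card_fin]
  rw [← Nat.cast_smul_eq_nsmul ℝ, smul_smul, mul_inv_cancel₀, one_smul]
  exact_mod_cast Nat.factorial_ne_zero k

end Jets

/-! ### Polynomial vector fields on Euclidean space -/

section PolyMap

open MvPolynomial

variable {d : ℕ}

/-- The vector field on `ℝ^d` with polynomial components. -/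
noncomputable def polyMap (p : Fin d → MvPolynomial (Fin d) ℝ) (x : EuclideanSpace ℝ (Fin d)) :
    EuclideanSpace ℝ (Fin d) :=
  WithLp.toLp 2 fun i => eval x.ofLp (p i)

theorem contDiff_eval (q : MvPolynomial (Fin d) ℝ) :
    ContDiff ℝ ∞ fun x : EuclideanSpace ℝ (Fin d) => eval x.ofLp q := by
  induction q using MvPolynomial.induction_on with
  | C a => simpa using contDiff_const
  | add p q hp hq => simpa using hp.add hq
  | mul_X p j hp => simpa using hp.mul (contDiff_euclidean.1 contDiff_id j)

theorem contDiff_polyMap (p : Fin d → MvPolynomial (Fin d) ℝ) : ContDiff ℝ ∞ (polyMap p) :=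
  contDiff_euclidean.2 fun i => contDiff_eval (p i)

theorem fderiv_eval (q : MvPolynomial (Fin d) ℝ) (x v : EuclideanSpace ℝ (Fin d)) :
    fderiv ℝ (fun x : EuclideanSpace ℝ (Fin d) => eval x.ofLp q) x v =
      eval x.ofLp (dirDeriv v.ofLp q) := by
  have hd : ∀ q : MvPolynomial (Fin d) ℝ,
      DifferentiableAt ℝ (fun x : EuclideanSpace ℝ (Fin d) => eval x.ofLp q) x := fun q =>
    (contDiff_eval q).differentiable (by simp) x
  induction q using MvPolynomial.induction_on with
  | C a => simp
  | add p q hp hq =>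
    simp only [map_add, ← hp, ← hq]
    rw [fderiv_fun_add (hd p) (hd q)]
    rfl
  | mul_X p j hp =>
    have hj : fderiv ℝ (fun x : EuclideanSpace ℝ (Fin d) => eval x.ofLp (X j)) x v = v.ofLp j := by
      simp only [eval_X]
      exact congrArg (fun L : EuclideanSpace ℝ (Fin d) →L[ℝ] ℝ => L v)
        (PiLp.proj 2 (𝕜 := ℝ) (fun _ : Fin d => ℝ) j).fderiv
    simp only [map_mul, Derivation.leibniz, smul_eq_mul, map_add, dirDeriv_X, ← hp]
    rw [fderiv_fun_mul (hd p) (hd (X j)), add_apply,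
      smul_apply, smul_apply, hj]
    simp

theorem listDeriv_eval (q : MvPolynomial (Fin d) ℝ) (L : List (EuclideanSpace ℝ (Fin d))) :
    (listDeriv (fun x : EuclideanSpace ℝ (Fin d) => eval x.ofLp q) L) =
      fun x => eval x.ofLp (iterDeriv (L.map WithLp.ofLp : List (Fin d → ℝ)) q) := by
  induction L with
  | nil => rfl
  | cons v L ih =>
    funext x
    rw [listDeriv, ih]
    refine (fderiv_eval _ x v).trans ?_
    rw [List.map_cons, ← Multiset.cons_coe, iterDeriv_cons]

theorem iteratedFDeriv_component {E : Type*} [NormedAddCommGroup E] [NormedSpace ℝ E]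
    {f : E → EuclideanSpace ℝ (Fin d)} (hf : ContDiff ℝ ∞ f) (n : ℕ) (x : E) (v : Fin n → E)
    (i : Fin d) : (iteratedFDeriv ℝ n f x v).ofLp i =
      iteratedFDeriv ℝ n (fun y => (f y).ofLp i) x v := by
  have := (PiLp.proj 2 (𝕜 := ℝ) (fun _ : Fin d => ℝ) i).iteratedFDeriv_comp_left
    (hf.contDiffAt (x := x)) (i := n) (mod_cast le_top)
  exact (congrArg (fun M => M v) this).symm

theorem elemDiff_polyMap {m : ℕ} (p : Fin (m + 1) → Fin d → MvPolynomial (Fin d) ℝ) (τ : Tree m)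
    (x : EuclideanSpace ℝ (Fin d)) (i : Fin d) :
    (τ.elemDiff (fun l => polyMap (p l)) x).ofLp i = algDiff p x.ofLp τ i := by
  induction τ using Tree.induction_children generalizing i with
  | h τ ih =>
    rw [Tree.elemDiff, iteratedFDeriv_component (contDiff_polyMap _)]
    change iteratedFDeriv ℝ _ (fun x : EuclideanSpace ℝ (Fin d) => eval x.ofLp (p τ.root i)) x _ = _
    rw [iteratedFDeriv_eq_listDeriv (contDiff_eval _), listDeriv_eval, algDiff_eq]
    refine congrArg (fun s => eval x.ofLp (iterDeriv s (p τ.root i))) ?_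
    conv_rhs => rw [← Multiset.coe_toList τ.children, Multiset.map_coe]
    have : List.ofFn (fun k => Tree.elemDiff (fun l => polyMap (p l)) (τ.children.toList.get k) x) =
        τ.children.toList.map fun c => Tree.elemDiff (fun l => polyMap (p l)) c x := by
      conv_rhs => rw [← List.ofFn_get τ.children.toList, List.map_ofFn]
      rfl
    rw [this, List.map_map]
    refine congrArg _ (List.map_congr_left fun c hc => funext fun j => ?_)
    exact ih c (Multiset.mem_toList.1 hc) j

/-- The polynomials that are the components of the elementary differential of `τ`: the elementary
differential at the generic point. -/
noncomputable def genericDiff {m : ℕ} (p : Fin (m + 1) → Fin d → MvPolynomial (Fin d) ℝ)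
    (τ : Tree m) : Fin d → MvPolynomial (Fin d) ℝ :=
  algDiff (fun l i => map C (p l i)) X τ

theorem aeval_genericDiff {m : ℕ} {S : Type*} [CommRing S] [Algebra ℝ S]
    (p : Fin (m + 1) → Fin d → MvPolynomial (Fin d) ℝ) (τ : Tree m) (Y : Fin d → S) (i : Fin d) :
    aeval Y (genericDiff p τ i) = algDiff (fun l i => map (algebraMap ℝ S) (p l i)) Y τ i := by
  have := map_algDiff (aeval Y : MvPolynomial (Fin d) ℝ →ₐ[ℝ] S).toRingHom
    (fun l i => map C (p l i)) X τ i
  refine this.trans ?_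
  congr 1
  · funext l i
    rw [map_map]
    congr 2
    exact RingHom.ext fun a => by simp
  · funext j
    simp

theorem elemDiff_polyMap_eq {m : ℕ} (p : Fin (m + 1) → Fin d → MvPolynomial (Fin d) ℝ)
    (τ : Tree m) : τ.elemDiff (fun l => polyMap (p l)) = polyMap (genericDiff p τ) := by
  funext x
  refine WithLp.ofLp_injective 2 (funext fun i => ?_)
  rw [elemDiff_polyMap, polyMap, ← coe_aeval_eq_eval]
  have := aeval_genericDiff p τ x.ofLp i
  simp only [Algebra.algebraMap_self, map_id] at this
  exact this.symm

/-- Every jet of a smooth vector field is the jet of a polynomial one. -/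
theorem exists_jetEq_polyMap {f : EuclideanSpace ℝ (Fin d) → EuclideanSpace ℝ (Fin d)}
    (hf : ContDiff ℝ ∞ f) (n : ℕ) (x : EuclideanSpace ℝ (Fin d)) :
    ∃ p, JetEq n f (polyMap p) x := by
  refine ⟨fun i => ∑ k ∈ Finset.range (n + 1), C ((k.factorial : ℝ)⁻¹) *
    ∑ r : Fin k → Fin d, (∏ j, (X (r j) - C (x.ofLp (r j)))) *
      C ((iteratedFDeriv ℝ k f x fun j => EuclideanSpace.single (r j) 1).ofLp i), ?_⟩
  convert jetEq_taylor hf n x using 1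
  funext y
  refine WithLp.ofLp_injective 2 (funext fun i => ?_)
  have hz : y - x = ∑ j, (y.ofLp j - x.ofLp j) • EuclideanSpace.single j (1 : ℝ) := by
    have := ((EuclideanSpace.basisFun (Fin d) ℝ).sum_repr (y - x)).symm
    simpa using this
  simp only [polyMap, map_sum, map_mul, eval_C, map_prod, map_sub, eval_X, WithLp.ofLp_sum,
    Finset.sum_apply, WithLp.ofLp_smul, Pi.smul_apply, smul_eq_mul]
  refine Finset.sum_congr rfl fun k _ => ?_
  congr 1
  rw [hz]
  have hM := (iteratedFDeriv ℝ k f x).map_sum (α := fun _ => Fin d)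
    fun _ j => (y.ofLp j - x.ofLp j) • EuclideanSpace.single j (1 : ℝ)
  rw [hM, WithLp.ofLp_sum, Finset.sum_apply]
  refine Finset.sum_congr rfl fun r _ => ?_
  rw [ContinuousMultilinearMap.map_smul_univ]
  rfl

end PolyMap

/-! ### Formal series and dual numbers over polynomials -/

section FormalSeries

variable {d : ℕ}

open TrivSqZeroExt

theorem taylorCoeff_polynomial (P : Polynomial ℝ) (n : ℕ) :
    taylorCoeff (fun t => P.eval t) n = P.coeff n := by
  have h : ∀ n, iteratedDeriv n (fun t => P.eval t) =
      fun t => (Polynomial.derivative^[n] P).eval t := by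
    intro n
    induction n with
    | zero => simp
    | succ n ih =>
      rw [iteratedDeriv_succ, ih]
      funext t
      rw [Polynomial.deriv, Function.iterate_succ_apply']
  rw [taylorCoeff, h]
  simp only [← Polynomial.coeff_zero_eq_eval_zero, Polynomial.coeff_iterate_derivative, zero_add,
    Nat.descFactorial_self, nsmul_eq_mul, smul_eq_mul]
  rw [inv_mul_cancel_left₀]
  exact_mod_cast Nat.factorial_ne_zero n

theorem taylorCoeff_component {c : ℝ → EuclideanSpace ℝ (Fin d)} (hc : ContDiff ℝ ∞ c) (n : ℕ)
    (i : Fin d) : (taylorCoeff c n).ofLp i = taylorCoeff (fun t => (c t).ofLp i) n := by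
  rw [taylorCoeff, taylorCoeff, iteratedDeriv_eq_iteratedFDeriv, iteratedDeriv_eq_iteratedFDeriv,
    ← iteratedFDeriv_component hc]
  rfl

theorem JetEq.taylorCoeff_eq {n : ℕ} {c c' : ℝ → EuclideanSpace ℝ (Fin d)}
    (h : JetEq n c c' 0) : taylorCoeff c n = taylorCoeff c' n := by
  rw [taylorCoeff, taylorCoeff, iteratedDeriv_eq_iteratedFDeriv, iteratedDeriv_eq_iteratedFDeriv,
    h.iteratedFDeriv_eq le_rfl]

theorem contDiff_truncCurve (Y : ℕ → EuclideanSpace ℝ (Fin d)) (N : ℕ) :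
    ContDiff ℝ ∞ (truncCurve Y N) :=
  ContDiff.sum fun n _ => (contDiff_id.pow n).smul contDiff_const

theorem truncCurve_zero (Y : ℕ → EuclideanSpace ℝ (Fin d)) (N : ℕ) : truncCurve Y N 0 = Y 0 := by
  rw [truncCurve, Finset.sum_range_succ']
  simp

/-- The components of the truncation of a formal series, as polynomials in `t`. -/
noncomputable def seriesPoly (Y : ℕ → EuclideanSpace ℝ (Fin d)) (N : ℕ) (j : Fin d) :
    Polynomial ℝ :=
  ∑ n ∈ Finset.range (N + 1), Polynomial.monomial n ((Y n).ofLp j)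

/-- The truncation of `Y + ε V` for formal series `Y` and `V`, as a point over the dual numbers of
`ℝ[t]`. -/
noncomputable def dualPoint (Y V : ℕ → EuclideanSpace ℝ (Fin d)) (N : ℕ) (j : Fin d) :
    DualNumber (Polynomial ℝ) :=
  inl (seriesPoly Y N j) + inr (seriesPoly V N j)

theorem eval_seriesPoly (Y : ℕ → EuclideanSpace ℝ (Fin d)) (N : ℕ) (j : Fin d) (t : ℝ) :
    (seriesPoly Y N j).eval t = (truncCurve Y N t).ofLp j := by
  simp [seriesPoly, truncCurve, Polynomial.eval_finsetSum, mul_comm]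

theorem coeff_seriesPoly (Y : ℕ → EuclideanSpace ℝ (Fin d)) {N n : ℕ} (hn : n ≤ N) (j : Fin d) :
    (seriesPoly Y N j).coeff n = (Y n).ofLp j := by
  simp [seriesPoly, Polynomial.coeff_monomial, hn]

open MvPolynomial in
theorem eval_fst_aeval_dualPoint (Y V : ℕ → EuclideanSpace ℝ (Fin d)) (N : ℕ)
    (q : MvPolynomial (Fin d) ℝ) (t : ℝ) :
    (aeval (dualPoint Y V N) q).fst.eval t = eval (truncCurve Y N t).ofLp q := by
  induction q using MvPolynomial.induction_on with
  | C a => simp [TrivSqZeroExt.algebraMap_eq_inl']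
  | add p q hp hq => simp [hp, hq]
  | mul_X p j hp => simp [hp, dualPoint, eval_seriesPoly]

open MvPolynomial in
theorem eval_snd_aeval_dualPoint (Y V : ℕ → EuclideanSpace ℝ (Fin d)) (N : ℕ)
    (q : MvPolynomial (Fin d) ℝ) (t : ℝ) :
    (aeval (dualPoint Y V N) q).snd.eval t =
      eval (truncCurve Y N t).ofLp (dirDeriv (truncCurve V N t).ofLp q) := by
  induction q using MvPolynomial.induction_on with
  | C a => simp [TrivSqZeroExt.algebraMap_eq_inl']
  | add p q hp hq => simp [hp, hq]
  | mul_X p j hp =>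
    simp [hp, dualPoint, eval_seriesPoly, Derivation.leibniz, eval_fst_aeval_dualPoint]
    ring

theorem coeff_of_inl_X_pow_dvd {n : ℕ} {z : DualNumber (Polynomial ℝ)}
    (h : inl (Polynomial.X ^ (n + 1)) ∣ z) : z.fst.coeff n = 0 ∧ z.snd.coeff n = 0 := by
  obtain ⟨r, rfl⟩ := h
  constructor
  · exact Polynomial.X_pow_dvd_iff.1 ⟨r.fst, by simp⟩ n (Nat.lt_succ_self n)
  · exact Polynomial.X_pow_dvd_iff.1 ⟨r.snd, by simp⟩ n (Nat.lt_succ_self n)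

/-- Lower coefficients do not depend on the order of the truncation. -/
theorem coeff_aeval_dualPoint (Y V : ℕ → EuclideanSpace ℝ (Fin d)) {N n : ℕ} (hn : n ≤ N)
    (q : MvPolynomial (Fin d) ℝ) :
    (MvPolynomial.aeval (dualPoint Y V N) q).fst.coeff n =
        (MvPolynomial.aeval (dualPoint Y V n) q).fst.coeff n ∧
      (MvPolynomial.aeval (dualPoint Y V N) q).snd.coeff n =
        (MvPolynomial.aeval (dualPoint Y V n) q).snd.coeff n := by
  have hpoly : ∀ (Y : ℕ → EuclideanSpace ℝ (Fin d)) (j : Fin d),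
      Polynomial.X ^ (n + 1) ∣ seriesPoly Y N j - seriesPoly Y n j := fun Y j => by
    refine Polynomial.X_pow_dvd_iff.2 fun k hk => ?_
    rw [Polynomial.coeff_sub, coeff_seriesPoly Y (by omega), coeff_seriesPoly Y (by omega),
      sub_self]
  have hdual : ∀ j, inl (Polynomial.X ^ (n + 1)) ∣ dualPoint Y V N j - dualPoint Y V n j := by
    intro j
    obtain ⟨a, ha⟩ := hpoly Y j
    obtain ⟨b, hb⟩ := hpoly V j
    refine ⟨inl a + inr b, TrivSqZeroExt.ext ?_ ?_⟩
    · simpa [dualPoint] using ha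
    · simpa [dualPoint] using hb
  have := coeff_of_inl_X_pow_dvd (aeval_sub_aeval_dvd hdual (MvPolynomial.map
    (algebraMap ℝ (DualNumber (Polynomial ℝ))) q))
  simp only [MvPolynomial.aeval_map_algebraMap, fst_sub, snd_sub, Polynomial.coeff_sub,
    sub_eq_zero] at this
  exact this

/-- The coefficients of `f(Y)` are those of `q` at `Y + ε V` without `ε`, if the polynomial `q` has the
jet of `f`. -/
theorem formalEval_component {f : EuclideanSpace ℝ (Fin d) → EuclideanSpace ℝ (Fin d)}
    {q : Fin d → MvPolynomial (Fin d) ℝ} {Y : ℕ → EuclideanSpace ℝ (Fin d)} {n : ℕ}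
    (h : JetEq n f (polyMap q) (Y 0)) (V : ℕ → EuclideanSpace ℝ (Fin d)) {N : ℕ} (hn : n ≤ N)
    (i : Fin d) :
    (formalEval f Y n).ofLp i = (MvPolynomial.aeval (dualPoint Y V N) (q i)).fst.coeff n := by
  have hc := contDiff_truncCurve Y n
  rw [← truncCurve_zero Y n] at h
  rw [formalEval, (h.comp_right hc).taylorCoeff_eq,
    taylorCoeff_component (h.comp_right hc).contDiff_right, (coeff_aeval_dualPoint Y V hn _).1,
    ← taylorCoeff_polynomial]
  simp only [eval_fst_aeval_dualPoint]
  rfl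

/-- The coefficients of `f'(Y) V` are those of `q` at `Y + ε V` with `ε`, if the polynomial `q` has the
jet of `f`. One more derivative has to agree. -/
theorem formalDeriv_component {f : EuclideanSpace ℝ (Fin d) → EuclideanSpace ℝ (Fin d)}
    {q : Fin d → MvPolynomial (Fin d) ℝ} {Y : ℕ → EuclideanSpace ℝ (Fin d)} {n : ℕ}
    (h : JetEq (n + 1) f (polyMap q) (Y 0)) (V : ℕ → EuclideanSpace ℝ (Fin d)) {N : ℕ}
    (hn : n ≤ N) (i : Fin d) :
    (formalDeriv f Y V n).ofLp i = (MvPolynomial.aeval (dualPoint Y V N) (q i)).snd.coeff n := by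
  have hc := contDiff_truncCurve Y n
  have hv := contDiff_truncCurve V n
  rw [← truncCurve_zero Y n] at h
  have hj := (h.fderiv.comp_right hc).clm_apply (JetEq.refl hv n 0)
  rw [formalDeriv, hj.taylorCoeff_eq, taylorCoeff_component hj.contDiff_right,
    (coeff_aeval_dualPoint Y V hn _).2, ← taylorCoeff_polynomial]
  simp only [eval_snd_aeval_dualPoint]
  congr 1
  funext t
  rw [← fderiv_eval]
  have hd := (contDiff_polyMap q).differentiable (by simp) (truncCurve Y n t)
  have := ((PiLp.proj 2 (𝕜 := ℝ) (fun _ : Fin d => ℝ) i).hasFDerivAt.comp _ hd.hasFDerivAt).fderiv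
  exact (congrArg (fun L : EuclideanSpace ℝ (Fin d) →L[ℝ] ℝ => L (truncCurve V n t)) this).symm

end FormalSeries

/-! ### Composition of B-series and the Newton iteration -/

section Composition

open TrivSqZeroExt

variable {d m : ℕ}

theorem mem_ofOrder2 {N : ℕ} {τ : T m} : τ ∈ T.ofOrder2 m N ↔ τ.order2 = N := by
  simp [T.ofOrder2]

theorem sum_ofOrder2 {M : Type*} [AddCommMonoid M] (N : ℕ) (G : T m → M) :
    ∑ k ∈ Finset.range (N + 1), ∑ τ ∈ T.ofOrder2 m k, G τ =
      G none + ∑ τ ∈ treesLE m N, G (some τ) := by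
  classical
  have h : ∀ τ ∈ Finset.insertNone (treesLE m N), T.order2 τ ∈ Finset.range (N + 1) := by
    rintro (_ | τ) hτ
    · simp [T.order2]
    · simpa [T.order2, Nat.lt_succ_iff] using hτ
  rw [← Finset.sum_insertNone, ← Finset.sum_fiberwise_of_maps_to h]
  refine Finset.sum_congr rfl fun k hk => Finset.sum_congr ?_ fun _ _ => rfl
  ext τ
  rw [mem_ofOrder2, Finset.mem_filter]
  refine ⟨fun hτ => ⟨?_, hτ⟩, fun hτ => hτ.2⟩
  rw [Finset.mem_range] at hk
  cases τ with
  | none => simp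
  | some τ =>
    simp only [T.order2] at hτ
    simp only [Finset.some_mem_insertNone, mem_treesLE]
    omega

/-- Sums over a splitting of the order into that of a tree and a remainder, by trees. -/
theorem sum_antidiagonal_ofOrder2 {M : Type*} [AddCommMonoid M] (N : ℕ) (G : T m → ℕ → M) :
    ∑ q ∈ Finset.HasAntidiagonal.antidiagonal N, ∑ τ ∈ T.ofOrder2 m q.1, G τ q.2 =
      G none N + ∑ τ ∈ treesLE m N, G (some τ) (N - τ.order2) := by
  rw [Finset.Nat.sum_antidiagonal_eq_sum_range_succ fun a b => ∑ τ ∈ T.ofOrder2 m a, G τ b]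
  have h : _ = G none N + ∑ τ ∈ treesLE m N, G (some τ) (N - τ.order2) :=
    sum_ofOrder2 (m := m) N fun τ => G τ (N - T.order2 τ)
  rw [← h]
  refine Finset.sum_congr rfl fun k _ => Finset.sum_congr rfl fun τ hτ => ?_
  rw [mem_ofOrder2.1 hτ]

/-- The polynomials representing the elementary differential of a possibly empty tree. -/
noncomputable def genericDiffT (p : Fin (m + 1) → Fin d → MvPolynomial (Fin d) ℝ) :
    T m → Fin d → MvPolynomial (Fin d) ℝ
  | none => MvPolynomial.X
  | some τ => genericDiff p τ

theorem jetEq_elemDiff {g : Fin (m + 1) → EuclideanSpace ℝ (Fin d) → EuclideanSpace ℝ (Fin d)}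
    {p : Fin (m + 1) → Fin d → MvPolynomial (Fin d) ℝ} {x₀ : EuclideanSpace ℝ (Fin d)} {N n : ℕ}
    (h : ∀ l, JetEq (n + N) (g l) (polyMap (p l)) x₀) (τ : T m) (hτ : τ.order2 ≤ N) :
    JetEq n (τ.elemDiff g) (polyMap (genericDiffT p τ)) x₀ := by
  cases τ with
  | none =>
    have : polyMap (genericDiffT p none) = T.elemDiff g none := by
      funext x
      refine WithLp.ofLp_injective 2 (funext fun i => ?_)
      simp [polyMap, genericDiffT, T.elemDiff]
    rw [this]
    exact JetEq.refl contDiff_id _ _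
  | some τ =>
    rw [genericDiffT, ← elemDiff_polyMap_eq, T.elemDiff]
    have := Tree.size_le_order2 τ
    simp only [T.order2] at hτ
    exact JetEq.elemDiff τ fun l => (h l).mono (by omega)

/-- A polynomial vector field over `ℝ` as one over the dual numbers of `ℝ[t]`. -/
noncomputable def dualField (p : Fin (m + 1) → Fin d → MvPolynomial (Fin d) ℝ)
    (l : Fin (m + 1)) (i : Fin d) : MvPolynomial (Fin d) (DualNumber (Polynomial ℝ)) :=
  MvPolynomial.map (algebraMap ℝ _) (p l i)

theorem treeCoeff_inl_X (τ : Tree m) :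
    treeCoeff (inl Polynomial.X : DualNumber (Polynomial ℝ)) τ =
      inl (Polynomial.monomial τ.order2 (τ.alpha : ℝ)) := by
  have h : algebraMap ℚ (DualNumber (Polynomial ℝ)) τ.alpha =
      inl (Polynomial.C (τ.alpha : ℝ)) := by
    have h1 : (algebraMap ℚ (DualNumber (Polynomial ℝ))) =
        (inlHom (Polynomial ℝ) (Polynomial ℝ)).comp (Polynomial.C.comp (algebraMap ℚ ℝ)) :=
      Subsingleton.elim _ _
    rw [h1]
    simp
  have h2 : (inl Polynomial.X : DualNumber (Polynomial ℝ)) ^ τ.order2 =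
      inl (Polynomial.X ^ τ.order2) := (map_pow (inlHom (Polynomial ℝ) (Polynomial ℝ)) _ _).symm
  rw [treeCoeff, h, h2, ← inl_mul, Polynomial.C_mul_X_pow_eq_monomial]

variable {g : Fin (m + 1) → EuclideanSpace ℝ (Fin d) → EuclideanSpace ℝ (Fin d)}
  {p : Fin (m + 1) → Fin d → MvPolynomial (Fin d) ℝ} {x₀ : EuclideanSpace ℝ (Fin d)}

theorem seriesPoly_bSeries (a : T m → ℝ) (N : ℕ) (j : Fin d) :
    seriesPoly (bSeries g a x₀) N j = Polynomial.C (a none) * Polynomial.C (x₀.ofLp j) +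
      ∑ τ ∈ treesLE m N, Polynomial.monomial τ.order2 (τ.alpha : ℝ) *
        Polynomial.C ((τ.elemDiff g x₀).ofLp j) * Polynomial.C (a (some τ)) := by
  have := sum_ofOrder2 (m := m) N fun τ => Polynomial.monomial τ.order2
    ((τ.alpha : ℝ) * a τ * (τ.elemDiff g x₀).ofLp j)
  refine (Eq.trans ?_ this).trans ?_
  · refine Finset.sum_congr rfl fun k _ => ?_
    rw [bSeries, WithLp.ofLp_sum, Finset.sum_apply, map_sum]
    refine Finset.sum_congr rfl fun τ hτ => ?_
    rw [mem_ofOrder2.1 hτ]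
    simp
  · congr 1
    · simp [T.order2, T.alpha, T.elemDiff]
    · refine Finset.sum_congr rfl fun τ _ => ?_
      rw [Polynomial.monomial_mul_C, Polynomial.monomial_mul_C]
      simp only [T.order2, T.alpha, T.elemDiff]
      congr 1
      ring

/-- At a real point, the algebraic B-series with the weights `a + ε b` is the truncation of
`B(a, x₀) + ε B(b, x₀)`. -/
theorem algSeries_perturb {N n : ℕ} (h : ∀ l, JetEq (n + N) (g l) (polyMap (p l)) x₀)
    (a b : T m → ℝ) :
    algSeries (dualField p) (inl Polynomial.X) N
        (perturb (fun τ => Polynomial.C (a τ)) fun τ => Polynomial.C (b τ))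
        (fun j => algebraMap ℝ _ (x₀.ofLp j)) =
      dualPoint (bSeries g a x₀) (bSeries g b x₀) N := by
  have hF : ∀ τ ∈ treesLE m N, ∀ j, algDiff (dualField p)
      (fun j => algebraMap ℝ (DualNumber (Polynomial ℝ)) (x₀.ofLp j)) τ j =
        inl (Polynomial.C ((τ.elemDiff g x₀).ofLp j)) := fun τ hτ j => by
    have h1 := (jetEq_elemDiff h (some τ) (mem_treesLE.1 hτ)).eq
    rw [T.elemDiff] at h1
    rw [h1]
    refine (aeval_genericDiff p τ _ j).symm.trans ?_
    exact MvPolynomial.aeval_algebraMap_apply (DualNumber (Polynomial ℝ)) x₀.ofLp _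
  funext j
  rw [algSeries, dualPoint, seriesPoly_bSeries, seriesPoly_bSeries,
    Finset.sum_congr rfl fun τ hτ => by rw [hF τ hτ j, treeCoeff_inl_X]]
  refine TrivSqZeroExt.ext ?_ ?_
  · simp [perturb, fst_sum, TrivSqZeroExt.algebraMap_eq_inl']
  · simp [perturb, snd_sum, TrivSqZeroExt.algebraMap_eq_inl', mul_comm]

/-- At `Y + ε V`, the algebraic B-series has the components `B(ψ, Y)` and `∂₂B(ψ, Y) V`. -/
theorem coeff_algSeries_dualPoint {N : ℕ}
    (h : ∀ l, JetEq (N + 1 + N) (g l) (polyMap (p l)) x₀) (ψ : T m → ℝ)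
    {Y : ℕ → EuclideanSpace ℝ (Fin d)} (hY : Y 0 = x₀) (V : ℕ → EuclideanSpace ℝ (Fin d))
    (j : Fin d) :
    (algSeries (dualField p) (inl Polynomial.X) N (fun τ => inl (Polynomial.C (ψ τ)))
        (dualPoint Y V N) j).fst.coeff N = (bSeriesAt g ψ Y N).ofLp j ∧
      (algSeries (dualField p) (inl Polynomial.X) N (fun τ => inl (Polynomial.C (ψ τ)))
        (dualPoint Y V N) j).snd.coeff N = (bSeriesDeriv g ψ Y V N).ofLp j := by
  have hj : ∀ τ : T m, τ.order2 ≤ N → JetEq (N + 1) (τ.elemDiff g) (polyMap (genericDiffT p τ))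
      (Y 0) := fun τ hτ => hY ▸ jetEq_elemDiff h τ hτ
  have h1 : ∀ τ : T m, τ.order2 ≤ N → ∀ n ≤ N, (formalEval (τ.elemDiff g) Y n).ofLp j =
      (MvPolynomial.aeval (dualPoint Y V N) (genericDiffT p τ j)).fst.coeff n :=
    fun τ hτ n hn => formalEval_component ((hj τ hτ).mono (by omega)) V hn j
  have h2 : ∀ τ : T m, τ.order2 ≤ N → ∀ n ≤ N, (formalDeriv (τ.elemDiff g) Y V n).ofLp j =
      (MvPolynomial.aeval (dualPoint Y V N) (genericDiffT p τ j)).snd.coeff n :=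
    fun τ hτ n hn => formalDeriv_component ((hj τ hτ).mono (by omega)) V hn j
  have h0 : T.order2 (none : T m) ≤ N := Nat.zero_le _
  have hF : ∀ τ, algDiff (dualField p) (dualPoint Y V N) τ j =
      MvPolynomial.aeval (dualPoint Y V N) (genericDiffT p (some τ) j) := fun τ =>
    (aeval_genericDiff p τ _ j).symm
  have hmon : ∀ (τ : Tree m) (P : Polynomial ℝ), τ ∈ treesLE m N →
      (Polynomial.monomial τ.order2 (τ.alpha : ℝ) * P * Polynomial.C (ψ (some τ))).coeff N =
        (τ.alpha : ℝ) * ψ (some τ) * P.coeff (N - τ.order2) := fun τ P hτ => by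
    rw [Polynomial.coeff_mul_C]
    conv_lhs => rw [← Nat.sub_add_cancel (mem_treesLE.1 hτ), Polynomial.coeff_monomial_mul]
    ring
  have e1 : dualPoint Y V N j = MvPolynomial.aeval (dualPoint Y V N) (genericDiffT p none j) := by
    simp [genericDiffT]
  constructor
  · rw [bSeriesAt, sum_antidiagonal_ofOrder2 N fun τ n =>
      ((τ.alpha : ℝ) * ψ τ) • formalEval (τ.elemDiff g) Y n]
    rw [algSeries, e1]
    simp only [hF, treeCoeff_inl_X, fst_add, fst_sum, fst_mul, fst_inl, Polynomial.coeff_add,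
      Polynomial.finsetSum_coeff, Polynomial.coeff_C_mul, WithLp.ofLp_add, WithLp.ofLp_sum,
      WithLp.ofLp_smul, Pi.add_apply, Finset.sum_apply, Pi.smul_apply, smul_eq_mul]
    rw [h1 none h0 N le_rfl]
    congr 1
    · simp [T.alpha]
    · refine Finset.sum_congr rfl fun τ hτ => ?_
      rw [hmon τ _ hτ, h1 (some τ) (mem_treesLE.1 hτ) _ (Nat.sub_le _ _)]
      rfl
  · rw [bSeriesDeriv, sum_antidiagonal_ofOrder2 N fun τ n =>
      ((τ.alpha : ℝ) * ψ τ) • formalDeriv (τ.elemDiff g) Y V n]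
    rw [algSeries, e1]
    simp only [hF, treeCoeff_inl_X, snd_add, snd_sum, snd_mul, snd_inl, fst_inl,
      Polynomial.coeff_add, Polynomial.finsetSum_coeff, WithLp.ofLp_add, WithLp.ofLp_sum,
      WithLp.ofLp_smul, Pi.add_apply, Finset.sum_apply, Pi.smul_apply, smul_eq_mul, smul_zero,
      add_zero, fst_mul, MulOpposite.smul_eq_mul_unop, MulOpposite.unop_op]
    rw [h2 none h0 N le_rfl]
    congr 1
    · simp [T.alpha]
    · refine Finset.sum_congr rfl fun τ hτ => ?_
      rw [h2 (some τ) (mem_treesLE.1 hτ) _ (Nat.sub_le _ _)]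
      rw [mul_zero, Polynomial.coeff_zero, zero_add, hmon τ _ hτ]
      rfl

theorem bSeries_add (a b : T m → ℝ) :
    bSeries g (fun τ => a τ + b τ) x₀ = bSeries g a x₀ + bSeries g b x₀ := by
  funext N
  simp [bSeries, mul_add, add_smul, Finset.sum_add_distrib]

theorem bSeries_sub (a b : T m → ℝ) :
    bSeries g (fun τ => a τ - b τ) x₀ = bSeries g a x₀ - bSeries g b x₀ := by
  funext N
  simp [bSeries, mul_sub, sub_smul, Finset.sum_sub_distrib]

theorem bSeries_zero (a : T m → ℝ) : bSeries g a x₀ 0 = a none • x₀ := by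
  have := sum_ofOrder2 (m := m) 0 fun τ => ((τ.alpha : ℝ) * a τ) • τ.elemDiff g x₀
  rw [Finset.sum_range_one] at this
  rw [bSeries, this, Finset.sum_eq_zero, add_zero]
  · simp [T.alpha, T.elemDiff]
  · intro τ hτ
    have h1 := Tree.size_le_order2 τ
    have h2 := τ.size_pos
    rw [mem_treesLE] at hτ
    omega

/-- `B(ψ, Y) + ∂₂B(ψ, Y) (Y' - Y)` for the B-series `Y`, `Y'` with weights `φ`, `φ'` is the B-series of
the linearised composition. This is the composition of B-series over the dual numbers, for the
polynomial vector fields with the same jets as the `g_l`. -/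
theorem bSeriesAt_add_bSeriesDeriv (hg : ∀ l, ContDiff ℝ ∞ (g l)) (φ φ' ψ : T m → ℝ)
    (hφ : φ none = 1) (hφ' : φ' none = 1) :
    bSeriesAt g ψ (bSeries g φ x₀) +
        bSeriesDeriv g ψ (bSeries g φ x₀) (bSeries g φ' x₀ - bSeries g φ x₀) =
      bSeries g (linComp φ φ' ψ) x₀ := by
  funext N
  choose p hp using fun l => exists_jetEq_polyMap (hg l) (N + 1 + N) x₀
  set φS : T m → DualNumber (Polynomial ℝ) :=
    perturb (fun τ => Polynomial.C (φ τ)) fun τ => Polynomial.C (φ' τ - φ τ) with hφS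
  set ψS : T m → DualNumber (Polynomial ℝ) := fun τ => inl (Polynomial.C (ψ τ)) with hψS
  have hcomp : comp φS ψS = perturb (fun τ => Polynomial.C (comp φ ψ τ))
      fun τ => Polynomial.C (linComp φ φ' ψ τ - comp φ ψ τ) := by
    funext τ
    have e1 := map_comp (Polynomial.C : ℝ →+* Polynomial ℝ) φ ψ τ
    have e2 := (map_linComp (Polynomial.C : ℝ →+* Polynomial ℝ) φ φ' ψ τ).trans
      (linComp_eq _ _ _ τ)
    refine TrivSqZeroExt.ext ?_ ?_
    · rw [hφS, hψS, fst_comp_perturb, ← e1]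
      simp [perturb]
    · rw [← e1] at e2
      simp only [hφS, hψS, perturb, map_sub] at e2 ⊢
      simp only [snd_add, snd_inl, snd_inr, zero_add, e2]
      ring
  have hY : bSeries g φ x₀ 0 = x₀ := by rw [bSeries_zero, hφ, one_smul]
  refine WithLp.ofLp_injective 2 (funext fun j => ?_)
  have hdvd := algSeries_comp (dualField p) (inl Polynomial.X) N φS ψS
    (by simp [hφS, perturb, hφ, hφ']) (fun j => algebraMap ℝ _ (x₀.ofLp j)) j
  rw [hcomp, algSeries_perturb hp, hφS, algSeries_perturb hp] at hdvd
  have h0 : (inl Polynomial.X : DualNumber (Polynomial ℝ)) ^ (N + 1) = inl (Polynomial.X ^ (N + 1)) :=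
    (map_pow (inlHom (Polynomial ℝ) (Polynomial ℝ)) _ _).symm
  have h1 := coeff_of_inl_X_pow_dvd (h0 ▸ hdvd)
  have h2 := coeff_algSeries_dualPoint hp ψ hY (bSeries g (fun τ => φ' τ - φ τ) x₀) j
  rw [fst_sub, snd_sub, Polynomial.coeff_sub, Polynomial.coeff_sub, h2.1, h2.2] at h1
  simp only [dualPoint, fst_add, snd_add, fst_inl, fst_inr, snd_inl, snd_inr, add_zero, zero_add,
    coeff_seriesPoly _ le_rfl, sub_eq_zero] at h1
  rw [← bSeries_sub, Pi.add_apply, WithLp.ofLp_add, Pi.add_apply, ← h1.1, ← h1.2, bSeries_sub]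
  simp

/-- The equation of the Newton step determines the next iterate: a coefficient of the derivative
term only involves lower coefficients of the increment. -/
theorem newtonStep_unique {ψ : T m → ℝ} (hψ : ψ none = 0) {A Y Z Z' : ℕ → EuclideanSpace ℝ (Fin d)}
    (h : Z = A + bSeriesDeriv g ψ Y (Z - Y)) (h' : Z' = A + bSeriesDeriv g ψ Y (Z' - Y)) :
    Z = Z' := by
  funext N
  induction N using Nat.strong_induction_on with
  | _ N ih =>
    rw [h, h', Pi.add_apply, Pi.add_apply]
    congr 1
    rw [bSeriesDeriv, bSeriesDeriv, sum_antidiagonal_ofOrder2 N fun τ n =>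
      ((τ.alpha : ℝ) * ψ τ) • formalDeriv (τ.elemDiff g) Y (Z - Y) n,
      sum_antidiagonal_ofOrder2 N fun τ n =>
      ((τ.alpha : ℝ) * ψ τ) • formalDeriv (τ.elemDiff g) Y (Z' - Y) n, hψ]
    simp only [mul_zero, zero_smul, zero_add]
    refine Finset.sum_congr rfl fun τ hτ => ?_
    have h1 := (τ.size_pos).trans_le (Tree.size_le_order2 τ)
    rw [mem_treesLE] at hτ
    have h2 : truncCurve (Z - Y) (N - τ.order2) = truncCurve (Z' - Y) (N - τ.order2) := by
      funext t
      refine Finset.sum_congr rfl fun n hn => ?_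
      rw [Finset.mem_range] at hn
      rw [Pi.sub_apply, Pi.sub_apply, ih n (by omega)]
    rw [formalDeriv, formalDeriv, h2]

/-- The Newton iterates are the B-series of the Newton weights: these satisfy the iteration by
`bSeriesAt_add_bSeriesDeriv`, and each step has only one solution. -/
theorem isNewtonIterates_iff (hg : ∀ l, ContDiff ℝ ∞ (g l)) {Φex Φim Φ0 : T m → ℝ}
    {Φs : ℕ → T m → ℝ} (him : Φim none = 0) (h0 : Φs 0 = Φ0) (h1 : ∀ k, Φs k none = 1)
    (hΦs : ∀ k τ, Φs (k + 1) τ = Φex τ + linComp (Φs k) (Φs (k + 1)) Φim τ)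
    (Y : ℕ → ℕ → EuclideanSpace ℝ (Fin d)) :
    IsNewtonIterates g Φex Φim Φ0 x₀ Y ↔ ∀ k, Y k = bSeries g (Φs k) x₀ := by
  have hstep : ∀ k, bSeries g (Φs (k + 1)) x₀ = bSeries g Φex x₀ +
      bSeriesAt g Φim (bSeries g (Φs k) x₀) + bSeriesDeriv g Φim (bSeries g (Φs k) x₀)
        (bSeries g (Φs (k + 1)) x₀ - bSeries g (Φs k) x₀) := fun k => by
    rw [add_assoc, bSeriesAt_add_bSeriesDeriv hg _ _ _ (h1 k) (h1 (k + 1)), ← bSeries_add]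
    exact congrArg (fun φ => bSeries g φ x₀) (funext (hΦs k))
  constructor
  · rintro ⟨hY0, hY⟩ k
    induction k with
    | zero => rw [hY0, h0]
    | succ k ih =>
      have hk := hY k
      rw [ih] at hk
      exact newtonStep_unique him hk (hstep k)
  · intro hY
    refine ⟨by rw [hY 0, h0], fun k => ?_⟩
    rw [hY, hY]
    exact hstep k

end Composition

end BSeries

theorem mainTheorem1 {Ω : Type*} [MeasurableSpace Ω] [Nonempty Ω] (d m : ℕ) :
    (∀ Φex Φim Φ0 : BSeries.T m → BSeries.Xi Ω, Φex none = 1 → Φim none = 0 → Φ0 none = 1 →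
      (∃! Φ : BSeries.T m → BSeries.Xi Ω, BSeries.IsMethodWeight Φex Φim Φ) ∧
      (∃! Φs : ℕ → BSeries.T m → BSeries.Xi Ω, BSeries.IsNewtonWeight Φex Φim Φ0 Φs) ∧
      ∀ (Φ : BSeries.T m → BSeries.Xi Ω) (Φs : ℕ → BSeries.T m → BSeries.Xi Ω),
        BSeries.IsMethodWeight Φex Φim Φ → BSeries.IsNewtonWeight Φex Φim Φ0 Φs →
        (∀ g : Fin (m + 1) → EuclideanSpace ℝ (Fin d) → EuclideanSpace ℝ (Fin d),
          (∀ l, ContDiff ℝ ∞ (g l)) →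
          ∀ (x₀ : EuclideanSpace ℝ (Fin d)) (h : ℝ≥0) (w : Ω)
            (Y : ℕ → ℕ → EuclideanSpace ℝ (Fin d)),
            BSeries.IsNewtonIterates g (fun τ => (Φex τ).1 h w) (fun τ => (Φim τ).1 h w)
                (fun τ => (Φ0 τ).1 h w) x₀ Y ↔
              ∀ k, Y k = BSeries.bSeries g (fun τ => (Φs k τ).1 h w) x₀) ∧
        BSeries.IsGrowthFunction BSeries.T.doubling Φ Φs ∧
        ∀ k τ, BSeries.T.doubling τ ≤ k → Φs k τ = Φ τ) ∧
    (∃ Φex Φim Φ0 : BSeries.T m → BSeries.Xi Ω, Φex none = 1 ∧ Φim none = 0 ∧ Φ0 none = 1 ∧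
      ∀ (Φ : BSeries.T m → BSeries.Xi Ω) (Φs : ℕ → BSeries.T m → BSeries.Xi Ω),
        BSeries.IsMethodWeight Φex Φim Φ → BSeries.IsNewtonWeight Φex Φim Φ0 Φs →
        ∀ k τ, k < BSeries.T.doubling τ → Φs k τ ≠ Φ τ) := by
  classical
  -- Evaluation at `h` and `w` is a ring homomorphism `Ξ → ℝ`.
  let ev : ℝ≥0 → Ω → BSeries.Xi Ω →+* ℝ := fun h w =>
    ((Pi.evalRingHom (fun _ : Ω => ℝ) w).comp
      (Pi.evalRingHom (fun _ : ℝ≥0 => Ω → ℝ) h)).comp (BSeries.Xi Ω).val.toRingHom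
  refine ⟨fun Φex Φim Φ0 hex him h0 => ⟨BSeries.existsUnique_methodWeight hex him,
    BSeries.existsUnique_newtonWeight hex him h0, fun Φ Φs hΦ hΦs => ?_⟩, ?_⟩
  · have h1 : ∀ k, Φs k none = 1
      | 0 => by rw [hΦs.1, h0]
      | k + 1 => (hΦs.2 k).1
    have hlin := ((BSeries.isNewtonWeight_iff hex him h0 Φs).1 hΦs).2
    have hgrowth := BSeries.isGrowthFunction_doubling him hΦ hlin
    refine ⟨fun g hg x₀ h w Y => ?_, hgrowth,
      fun k => BSeries.eq_of_doubling_le hΦ.1 (h1 0) hgrowth k⟩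
    refine BSeries.isNewtonIterates_iff hg (Φs := fun k τ => ev h w (Φs k τ)) ?_ ?_ ?_ ?_ Y
    · change ev h w (Φim none) = 0
      rw [him, map_zero]
    · rw [hΦs.1]
      rfl
    · intro k
      rw [h1, map_one]
    · intro k τ
      rw [hlin, map_add, BSeries.map_linComp]
      rfl
  · refine ⟨BSeries.unitWeight, BSeries.vertexWeight m _, BSeries.unitWeight, rfl, rfl, rfl,
      fun Φ Φs hΦ hΦs k τ hk heq => ?_⟩
    have hlin := ((BSeries.isNewtonWeight_iff rfl rfl rfl Φs).1 hΦs).2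
    cases τ with
    | none => exact absurd hk (Nat.not_lt_zero k)
    | some τ =>
      set f := ev 0 (Classical.arbitrary Ω)
      have hlt := BSeries.newton_strict (Φs := fun k τ => f (Φs k τ))
        (by funext σ; rw [hΦs.1, BSeries.map_unitWeight])
        (fun k σ => by
          rw [hlin, map_add, BSeries.map_linComp, BSeries.map_unitWeight]
          simp only [BSeries.map_vertexWeight]) k τ hk
      have hone := BSeries.methodWeight_vertexWeight (m := m) (Φ := fun σ => f (Φ σ)) ?_ (some τ)
      · rw [heq] at hlt
        exact hlt.ne hone
      · have := hΦ.map f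
        simpa only [BSeries.map_unitWeight, BSeries.map_vertexWeight] using this
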